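/- Let $\mathbb K\in\{\mathbb R,\mathbb C\}$, let $K$ be a compact Hausdorff space, and let $X$ be a Banach space over $\mathbb K$. **Diametral points.** For a Banach space $E$, a slice of the closed unit ball $B_E$ is a set $S(x^*,\varepsilon)=\{y\in B_E:\operatorname{Re}x^*(y)>1-\varepsilon\}$ with $\|x^*\|=1$, $\varepsilon>0$; a convex combination of slices (ccs) is a set $\{\sum_{i=1}^n\lambda_iy_i:\ y_i\in S_i\}$ with $S_i$ slices, $\lambda_i>0$, $\sum_i\lambda_i=1$. A point $x\in S_E$ (the unit sphere) is *ccs-Daugavet* (resp. *super-Daugavet*, *Daugavet*) if $\sup_{y\in C}\|x-y\|=2$ for every ccs (resp. every nonempty relatively weakly open subset, every slice) $C$ of $B_E$; it is *ccs-$\Delta$* (resp. *super-$\Delta$*, *$\Delta$*) if this holds for every such $C$ that contains $x$; it is $\nabla$ if it holds for every slice that does not contain $x$. For $p>1$, $x$ is $\Delta_p$ if whenever $x\in S(x^*,\alpha)$ and $\varepsilon>0$ there is $u\in S(x^*,p\alpha)$ with $\|x-u\|\ge 2-\varepsilon$. **The space.** Let $A(K,X)$ be a closed subspace of $C(K,X)$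 (with the supremum norm) such that the base algebra $A=\{x^*\circ g: x^*\in X^*,\ g\in A(K,X)\}$ is a uniform algebra on $K$ (a closed subalgebra of $C(K)$ that contains the constants and separates points), $A\otimes X\subset A(K,X)$, and $\varphi g\in A(K,X)$ for all $\varphi\in A$, $g\in A(K,X)$. Let $\Gamma$ be the Shilov boundary of $A$ (the smallest closed subset of $K$ on which every function of $A$ attains its norm), and let $\Gamma'$ be its set of limit points. Let $f\in A(K,X)$ with $\|f\|=1$. **Theorem.** 1. If $\|f(t_0)\|=\|f\|$ for some $t_0\in\Gamma'$, then $f$ is a ccs-Daugavet point of $A(K,X)$. 2. Otherwise, let $T=\{t_1,\dots,t_n\}$ be the set of isolated points $t$ of $\Gamma$ with $\|f(t)\|=\|f\|$. Then $T$ is finite and nonempty, every function $T\to X$ is the restriction to $T$ of some $h\in A(K,X)$ that vanishes on $\Gamma\setminus T$ (so that the space $A(T,X)$ of restrictions to $T$ is $X\oplus_\infty\overset{n)}{\cdots}\oplus_\infty X$), and: - (a) $f$ is super-Daugavet (resp. super-$\Delta$, ccs-Daugavet) in $A(K,X)$ if and only if $f|_T$ is super-Daugavet (resp. super-$\Delta$,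 ccs-Daugavet) in $X\oplus_\infty\overset{n)}{\cdots}\oplus_\infty X$. - (b) $f$ is Daugavet if and only if $f(t_0)$ is Daugavet in $X$ for some $t_0\in T$. - (c) If $f$ is ccs-$\Delta$, then $f|_T$ is ccs-$\Delta$ in $X\oplus_\infty\overset{n)}{\cdots}\oplus_\infty X$. - (d) $f$ is $\Delta$ if and only if either $f(t_k)$ is $\Delta$ in $X$ for some $k$, or $n\ge2$ and for all $p_1,\dots,p_n\in(1,\infty)$ with $\sum_{k=1}^n\frac1{p_k}=1$ there is some $k$ such that $f(t_k)$ is $\Delta_{p_k}$ in $X$. - (e) If $\Gamma\ne T$, or if $\mathbb K=\mathbb C$, then $f$ is $\nabla$ if and only if $f$ is Daugavet. - (f) If $\Gamma=T$, then $f$ is $\nabla$ if and only if either $f(t_i)$ is $\nabla$ in $X$ for all $1\le i\le n$, or $f(t_0)$ is Daugavet in $X$ for some $t_0\in T$ (and in this last case $f$ is Daugavet as well). -/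

import Mathlib

open scoped Topology

noncomputable section

/-! ### Slices and diametral points of the unit ball of a normed space -/

section Points

variable (𝕜 : Type*) [RCLike 𝕜] {E : Type*} [NormedAddCommGroup E] [NormedSpace 𝕜 E]

/-- The slice `S(D, x*, ε) = {x ∈ D : Re x*(x) > sup_{y ∈ D} Re x*(y) - ε}`. -/
def slice (D : Set E) (φ : StrongDual 𝕜 E) (ε : ℝ) : Set E :=
  {x | x ∈ D ∧ sSup ((fun y => RCLike.re (φ y)) '' D) - ε < RCLike.re (φ x)}

/-- `S` is a slice of the closed unit ball (by a norm-one functional and a positive `ε`). -/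
def IsBallSlice (S : Set E) : Prop :=
  ∃ (φ : StrongDual 𝕜 E) (ε : ℝ), ‖φ‖ = 1 ∧ 0 < ε ∧ S = slice 𝕜 (Metric.closedBall 0 1) φ ε

/-- `C` is a convex combination of slices of the closed unit ball. -/
def IsConvexCombSlices (C : Set E) : Prop :=
  ∃ (n : ℕ) (lam : Fin n → ℝ) (S : Fin n → Set E),
    (∀ i, 0 < lam i) ∧ ∑ i, lam i = 1 ∧ (∀ i, IsBallSlice 𝕜 (S i)) ∧
    C = {x | ∃ y : Fin n → E, (∀ i, y i ∈ S i) ∧ x = ∑ i, ((lam i : ℝ) : 𝕜) • y i}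

/-- `W` is a relatively weakly open subset of the closed unit ball. -/
def IsBallWeaklyOpen (W : Set E) : Prop :=
  ∃ V : Set (WeakSpace 𝕜 E), IsOpen V ∧
    W = {x | x ∈ Metric.closedBall (0 : E) 1 ∧ toWeakSpace 𝕜 E x ∈ V}

/-- `sup_{y ∈ S} ‖x - y‖ = 2` (in particular `S` is nonempty). -/
def SupDistEqTwo (x : E) (S : Set E) : Prop :=
  IsLUB ((fun y => ‖x - y‖) '' S) 2

def IsCcsDaugavetPoint (x : E) : Prop :=
  ‖x‖ = 1 ∧ ∀ C : Set E, IsConvexCombSlices 𝕜 C → SupDistEqTwo x C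

def IsSuperDaugavetPoint (x : E) : Prop :=
  ‖x‖ = 1 ∧ ∀ W : Set E, IsBallWeaklyOpen 𝕜 W → W.Nonempty → SupDistEqTwo x W

def IsDaugavetPoint (x : E) : Prop :=
  ‖x‖ = 1 ∧ ∀ S : Set E, IsBallSlice 𝕜 S → SupDistEqTwo x S

def IsCcsDeltaPoint (x : E) : Prop :=
  ‖x‖ = 1 ∧ ∀ C : Set E, IsConvexCombSlices 𝕜 C → x ∈ C → SupDistEqTwo x C

def IsSuperDeltaPoint (x : E) : Prop :=
  ‖x‖ = 1 ∧ ∀ W : Set E, IsBallWeaklyOpen 𝕜 W → x ∈ W → SupDistEqTwo x W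

def IsDeltaPoint (x : E) : Prop :=
  ‖x‖ = 1 ∧ ∀ S : Set E, IsBallSlice 𝕜 S → x ∈ S → SupDistEqTwo x S

def IsNablaPoint (x : E) : Prop :=
  ‖x‖ = 1 ∧ ∀ S : Set E, IsBallSlice 𝕜 S → x ∉ S → SupDistEqTwo x S

/-- `Δ_p` points: whenever `x ∈ S(x*, α)` and `ε > 0`, some `u ∈ S(x*, p α)` satisfies
`‖x - u‖ ≥ 2 - ε`. -/
def IsDeltaPPoint (p : ℝ) (x : E) : Prop :=
  ‖x‖ = 1 ∧ ∀ (φ : StrongDual 𝕜 E) (α ε : ℝ), ‖φ‖ = 1 → 0 < α → 0 < ε →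
    x ∈ slice 𝕜 (Metric.closedBall 0 1) φ α →
    ∃ u ∈ slice 𝕜 (Metric.closedBall 0 1) φ (p * α), 2 - ε ≤ ‖x - u‖

end Points

/-! ### The spaces `A(K, X)` and the Shilov boundary -/

section Spaces

variable {𝕜 : Type*} [RCLike 𝕜] {K : Type*} [TopologicalSpace K] [CompactSpace K]
  {X : Type*} [NormedAddCommGroup X] [NormedSpace 𝕜 X]

/-- The set `B` is a uniform algebra on `K`: a closed subalgebra of `C(K)` that contains the
constants and separates the points of `K`. -/
def IsUniformAlgebra (B : Set C(K, 𝕜)) : Prop :=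
  ∃ S : Subalgebra 𝕜 C(K, 𝕜), (S : Set C(K, 𝕜)) = B ∧ IsClosed (S : Set C(K, 𝕜)) ∧
    S.SeparatesPoints

/-- The base algebra `{x* ∘ f : x* ∈ X*, f ∈ A(K, X)}`. -/
def baseAlgebra (A : Submodule 𝕜 C(K, X)) : Set C(K, 𝕜) :=
  {φ | ∃ (ξ : StrongDual 𝕜 X) (f : C(K, X)), f ∈ A ∧ ∀ t, φ t = ξ (f t)}

/-- `A` is an `A(K, X)` space. -/
structure IsAKX (A : Submodule 𝕜 C(K, X)) : Prop where
  isClosed : IsClosed (A : Set C(K, X))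
  base : IsUniformAlgebra (baseAlgebra A)
  tensor_mem : ∀ φ ∈ baseAlgebra A, ∀ x : X, φ • ContinuousMap.const K x ∈ A
  smul_mem : ∀ φ ∈ baseAlgebra A, ∀ g ∈ A, φ • g ∈ A

/-- `S` is a boundary for `B`: every function in `B` attains its norm on `S`. -/
def IsBoundaryFor (B : Set C(K, 𝕜)) (S : Set K) : Prop :=
  ∀ φ ∈ B, ∃ t ∈ S, ‖φ t‖ = ‖φ‖

/-- The Shilov boundary (smallest closed boundary) of `B`, as the intersection of all closed
boundaries. -/
def shilovBoundary (B : Set C(K, 𝕜)) : Set K :=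
  ⋂₀ {S | IsClosed S ∧ IsBoundaryFor B S}

/-- The isolated points of `G` at which `f` attains its norm. -/
def isolatedNormPoints (G : Set K) (f : C(K, X)) : Set K :=
  {t | t ∈ G ∧ t ∉ derivedSet G ∧ ‖f t‖ = ‖f‖}

/-- The restriction `f|_T`, in the `ℓ_∞`-sum of `#T` copies of `X` (functions `T → X` with the
maximum norm). -/
def restrictTo (T : Finset K) (f : C(K, X)) : T → X := fun t => f t

end Spaces

end

/-! The proof splits according to where `f` attains its norm on the Shilov boundary Γ.

If it does so at a limit point of Γ, there are arbitrarily many disjoint open pieces on which ‖f‖ is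
almost 1. Each carries a function p of the base algebra that is 1 at some point of the piece, tiny
off the piece, and has values close to the segment [0,1], so that |p| + |1 - p| is at most about 1.
Replacing g by (1 - p)g - pf keeps the norm near 1 and produces -f at the peak. A functional cannot
react strongly to many disjoint perturbations, so some piece barely affects any of the finitely many
functionals defining a ccs. Using that one piece in every slice makes the average nearly -f at its
peak (`isCcsDaugavetPoint_of_mem_derivedSet`).

Otherwise T is finite by compactness. Powers of a peak function converge to an element of the
algebra that is the indicator of an isolated point on Γ, so restriction to T is a projection onto an
ℓ_∞-summand (`IsAKX.exists_isMSummand_restrictCLM`). The complementary part of `f` has norm below 1,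
so a distance to `f` close to 2 is already seen on T. Slices, ccs and weakly open sets are pulled
back along the projection, or pushed down by freezing the complementary component; this transfers
the diametral notions.

What remains concerns a finite ℓ_∞-sum, whose dual is an ℓ_1-sum. A slice inside a product of slices
(`exists_functional_pi`) turns failure in every coordinate into failure of the sum. Conversely one
well-chosen coordinate suffices; for Δ, the numbers p_k describe how the deficit allowed by a slice
is shared among coordinates. For ∇, the only slices not obviously covered come from functionals
norming the point; a complex rotation, or a mixture with a functional living on a nonzero
complement, supplies a usable slice that misses the point. -/

noncomputable section

/-! ### Slices, distance two, and the passage from ∇ to Daugavet. -/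

section Basics

variable {𝕜 : Type*} [RCLike 𝕜] {E : Type*} [NormedAddCommGroup E] [NormedSpace 𝕜 E]

theorem re_apply_le_norm (φ : StrongDual 𝕜 E) {x : E} (hx : ‖x‖ ≤ 1) :
    RCLike.re (φ x) ≤ ‖φ‖ :=
  ((RCLike.re_le_norm _).trans (φ.le_opNorm x)).trans
    (mul_le_of_le_one_right (norm_nonneg _) hx)

theorem exists_re_apply_gt (φ : StrongDual 𝕜 E) {r : ℝ} (hr : r < ‖φ‖) :
    ∃ x : E, ‖x‖ ≤ 1 ∧ r < RCLike.re (φ x) := by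
  rcases lt_or_ge r 0 with h0 | h0
  · exact ⟨0, by simp, by simpa using h0⟩
  · lift r to NNReal using h0
    obtain ⟨x, hx, hrx⟩ := φ.exists_lt_apply_of_lt_opNorm hr
    obtain ⟨c, hc, hcx⟩ := RCLike.exists_norm_eq_mul_self (φ x)
    refine ⟨c • x, by simpa [norm_smul, hc] using hx.le, ?_⟩
    rw [map_smul, smul_eq_mul, ← hcx, RCLike.ofReal_re]
    exact hrx

theorem sSup_re_image_closedBall (φ : StrongDual 𝕜 E) :
    sSup ((fun y => RCLike.re (φ y)) '' Metric.closedBall (0 : E) 1) = ‖φ‖ := by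
  refine csSup_eq_of_forall_le_of_forall_lt_exists_gt ⟨_, 0, by simp, rfl⟩ ?_ ?_
  · rintro _ ⟨x, hx, rfl⟩
    exact re_apply_le_norm φ (by simpa using hx)
  · intro r hr
    obtain ⟨x, hx, h⟩ := exists_re_apply_gt φ hr
    exact ⟨_, ⟨x, by simpa using hx, rfl⟩, h⟩

theorem mem_slice_closedBall {φ : StrongDual 𝕜 E} {ε : ℝ} {x : E} :
    x ∈ slice 𝕜 (Metric.closedBall 0 1) φ ε ↔ ‖x‖ ≤ 1 ∧ ‖φ‖ - ε < RCLike.re (φ x) := by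
  simp only [slice, Set.mem_ofPred_eq, sSup_re_image_closedBall, mem_closedBall_zero_iff]

theorem IsBallSlice.exists_mem_iff {S : Set E} (hS : IsBallSlice 𝕜 S) :
    ∃ (φ : StrongDual 𝕜 E) (ε : ℝ), ‖φ‖ = 1 ∧ 0 < ε ∧
      ∀ x, x ∈ S ↔ ‖x‖ ≤ 1 ∧ 1 - ε < RCLike.re (φ x) := by
  obtain ⟨φ, ε, h1, h2, rfl⟩ := hS
  exact ⟨φ, ε, h1, h2, fun x => by rw [mem_slice_closedBall, h1]⟩

theorem isBallSlice_of_mem_iff {S : Set E} {φ : StrongDual 𝕜 E} {ε : ℝ} (hφ : ‖φ‖ = 1)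
    (hε : 0 < ε) (h : ∀ x, x ∈ S ↔ ‖x‖ ≤ 1 ∧ 1 - ε < RCLike.re (φ x)) : IsBallSlice 𝕜 S :=
  ⟨φ, ε, hφ, hε, by ext x; rw [h, mem_slice_closedBall, hφ]⟩

/-- The slice of the unit ball where `Re φ` exceeds `r`. -/
def gtSlice (φ : StrongDual 𝕜 E) (r : ℝ) : Set E := {x | ‖x‖ ≤ 1 ∧ r < RCLike.re (φ x)}

theorem isBallSlice_gtSlice {φ : StrongDual 𝕜 E} {r : ℝ} (hφ : φ ≠ 0) (hr : r < ‖φ‖) :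
    IsBallSlice 𝕜 (gtSlice φ r) := by
  have h0 : 0 < ‖φ‖ := norm_pos_iff.2 hφ
  refine isBallSlice_of_mem_iff (φ := ((‖φ‖⁻¹ : ℝ) : 𝕜) • φ) (ε := 1 - r / ‖φ‖) ?_ ?_ ?_
  · rw [norm_smul, RCLike.norm_ofReal, abs_of_pos (inv_pos.2 h0), inv_mul_cancel₀ h0.ne']
  · rw [sub_pos, div_lt_one h0]; exact hr
  · intro x
    simp only [gtSlice, Set.mem_ofPred_eq, sub_sub_cancel, smul_apply,
      smul_eq_mul, RCLike.re_ofReal_mul, ← div_eq_inv_mul, div_lt_div_iff_of_pos_right h0]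

theorem IsBallSlice.nonempty {S : Set E} (hS : IsBallSlice 𝕜 S) : S.Nonempty := by
  obtain ⟨φ, ε, h1, h2, h⟩ := hS.exists_mem_iff
  obtain ⟨x, hx⟩ := exists_re_apply_gt φ (r := 1 - ε) (by linarith)
  exact ⟨x, (h x).2 hx⟩

theorem IsBallSlice.norm_le {S : Set E} (hS : IsBallSlice 𝕜 S) {x : E} (hx : x ∈ S) :
    ‖x‖ ≤ 1 := by
  obtain ⟨φ, ε, h1, h2, h⟩ := hS.exists_mem_iff
  exact ((h x).1 hx).1

theorem norm_convexCombination_le {n : ℕ} {lam : Fin n → ℝ} (h0 : ∀ i, 0 < lam i)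
    (h1 : ∑ i, lam i = 1) {y : Fin n → E} (hy : ∀ i, ‖y i‖ ≤ 1) :
    ‖∑ i, ((lam i : ℝ) : 𝕜) • y i‖ ≤ 1 := by
  refine (norm_sum_le _ _).trans (h1 ▸ Finset.sum_le_sum fun i _ => ?_)
  rw [norm_smul, RCLike.norm_ofReal, abs_of_pos (h0 i)]
  exact mul_le_of_le_one_right (h0 i).le (hy i)

theorem IsConvexCombSlices.norm_le {C : Set E} (hC : IsConvexCombSlices 𝕜 C) {x : E}
    (hx : x ∈ C) : ‖x‖ ≤ 1 := by
  obtain ⟨n, lam, S, h0, h1, hS, rfl⟩ := hC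
  obtain ⟨y, hy, rfl⟩ := hx
  exact norm_convexCombination_le h0 h1 fun i => (hS i).norm_le (hy i)

theorem IsBallWeaklyOpen.norm_le {W : Set E} (hW : IsBallWeaklyOpen 𝕜 W) {x : E}
    (hx : x ∈ W) : ‖x‖ ≤ 1 := by
  obtain ⟨V, hV, rfl⟩ := hW
  simpa using hx.1

theorem supDistEqTwo_iff {x : E} (hx : ‖x‖ ≤ 1) {S : Set E} (hS : ∀ y ∈ S, ‖y‖ ≤ 1) :
    SupDistEqTwo x S ↔ ∀ ε > 0, ∃ y ∈ S, 2 - ε < ‖x - y‖ := by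
  constructor
  · intro h ε hε
    obtain ⟨_, ⟨y, hy, rfl⟩, h1, -⟩ := h.exists_between (show 2 - ε < 2 by linarith)
    exact ⟨y, hy, h1⟩
  · refine fun h => ⟨?_, fun b hb => ?_⟩
    · rintro _ ⟨y, hy, rfl⟩
      have := norm_sub_le x y
      have := hS y hy
      show ‖x - y‖ ≤ 2
      linarith
    · by_contra! hlt
      obtain ⟨y, hy, h1⟩ := h (2 - b) (by linarith)
      have := hb ⟨y, hy, rfl⟩
      simp only at this
      linarith

theorem SupDistEqTwo.mono {x : E} (hx : ‖x‖ ≤ 1) {S S' : Set E} (h : SupDistEqTwo x S)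
    (hSS : S ⊆ S') (hS' : ∀ y ∈ S', ‖y‖ ≤ 1) : SupDistEqTwo x S' := by
  rw [supDistEqTwo_iff hx hS']
  intro ε hε
  obtain ⟨y, hy, h⟩ := (supDistEqTwo_iff hx fun y hy => hS' y (hSS hy)).1 h ε hε
  exact ⟨y, hSS hy, h⟩

theorem IsDaugavetPoint.isNablaPoint {x : E} (h : IsDaugavetPoint 𝕜 x) : IsNablaPoint 𝕜 x :=
  ⟨h.1, fun S hS _ => h.2 S hS⟩

/-- For a `∇` point, only the slices given by functionals that norm the point are not covered. -/
theorem IsNablaPoint.isDaugavetPoint_of_forall {x : E} (h : IsNablaPoint 𝕜 x)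
    (H : ∀ φ : StrongDual 𝕜 E, ‖φ‖ = 1 → RCLike.re (φ x) = 1 → ∀ ε > 0,
      SupDistEqTwo x (gtSlice φ (1 - ε))) : IsDaugavetPoint 𝕜 x := by
  refine ⟨h.1, fun S hS => ?_⟩
  obtain ⟨φ, ε, h1, h2, hS'⟩ := hS.exists_mem_iff
  have hSeq : S = gtSlice φ (1 - ε) := Set.ext hS'
  have hle := re_apply_le_norm φ h.1.le
  rw [h1] at hle
  rcases hle.eq_or_lt with he | hlt
  · exact hSeq ▸ H φ h1 he ε h2
  · have hφ : φ ≠ 0 := by rintro rfl; simp at h1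
    -- Raising the threshold to at least `Re φ x` shrinks the slice to one that misses `x`, still
    -- nonempty because `Re φ x < 1`.
    refine SupDistEqTwo.mono h.1.le (h.2 (gtSlice φ (max (1 - ε) (RCLike.re (φ x)))) ?_ ?_) ?_ ?_
    · exact isBallSlice_gtSlice hφ (by rw [h1]; exact max_lt (by linarith) hlt)
    · exact fun hx => absurd hx.2 (not_lt.2 (le_max_right _ _))
    · rw [hSeq]
      exact fun y hy => ⟨hy.1, (le_max_left _ _).trans_lt hy.2⟩
    · exact fun y hy => hS.norm_le hy

/-- The witness is cos θ + i sin θ with θ > 0 small. It is used to rotate a norming functional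
slightly. -/
theorem exists_norm_one_re_lt_one_norm_sub_lt (hI : (RCLike.I : 𝕜) ≠ 0) {ε : ℝ} (hε : 0 < ε) :
    ∃ c : 𝕜, ‖c‖ = 1 ∧ RCLike.re c < 1 ∧ 1 - ε < RCLike.re c ∧ ‖c - 1‖ < ε := by
  have hI1 : RCLike.im (RCLike.I : 𝕜) = 1 := RCLike.I_eq_zero_or_im_I_eq_one.resolve_left hI
  have hcont : Filter.Tendsto (fun θ : ℝ => 1 - Real.cos θ + |Real.sin θ|) (𝓝[>] 0) (𝓝 0) := by
    have : Continuous fun θ : ℝ => 1 - Real.cos θ + |Real.sin θ| := by fun_prop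
    simpa using (this.tendsto 0).mono_left nhdsWithin_le_nhds
  obtain ⟨θ, hθ, hθ0, hθ1⟩ := ((hcont.eventually (gt_mem_nhds hε)).and
    (Ioo_mem_nhdsGT (show (0 : ℝ) < 1 by norm_num))).exists
  have hcos : Real.cos θ < 1 := by
    have := Real.cos_lt_cos_of_nonneg_of_le_pi le_rfl (by linarith [Real.pi_gt_three]) hθ0
    simpa using this
  have hre : RCLike.re ((Real.cos θ : 𝕜) + (Real.sin θ : 𝕜) * RCLike.I) = Real.cos θ := by
    simp
  have him : RCLike.im ((Real.cos θ : 𝕜) + (Real.sin θ : 𝕜) * RCLike.I) = Real.sin θ := by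
    simp [hI1]
  refine ⟨(Real.cos θ : 𝕜) + (Real.sin θ : 𝕜) * RCLike.I, ?_, by rwa [hre], ?_, ?_⟩
  · have h1 := RCLike.norm_sq_eq_def (z := (Real.cos θ : 𝕜) + (Real.sin θ : 𝕜) * RCLike.I)
    rw [hre, him] at h1
    have h2 := Real.sin_sq_add_cos_sq θ
    have h3 := norm_nonneg ((Real.cos θ : 𝕜) + (Real.sin θ : 𝕜) * RCLike.I)
    nlinarith
  · rw [hre]; linarith [abs_nonneg (Real.sin θ)]
  · have hle : ∀ z : 𝕜, ‖z‖ ≤ |RCLike.re z| + |RCLike.im z| := fun z => by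
      rw [← pow_le_pow_iff_left₀ (norm_nonneg _) (by positivity) two_ne_zero,
        RCLike.norm_sq_eq_def]
      nlinarith [abs_nonneg (RCLike.re z), abs_nonneg (RCLike.im z),
        abs_mul_abs_self (RCLike.re z), abs_mul_abs_self (RCLike.im z)]
    refine (hle _).trans_lt ?_
    rw [map_sub, map_sub, hre, him, RCLike.one_re, RCLike.one_im, sub_zero, abs_sub_comm,
      abs_of_pos (by linarith)]
    exact hθ

/-- In a complex space, `∇` points are Daugavet points. -/
theorem IsNablaPoint.isDaugavetPoint_of_complex (hI : (RCLike.I : 𝕜) ≠ 0) {x : E}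
    (h : IsNablaPoint 𝕜 x) : IsDaugavetPoint 𝕜 x := by
  refine h.isDaugavetPoint_of_forall fun φ hφ hφx ε hε => ?_
  obtain ⟨c, hc, hc1, hc2, hc3⟩ := exists_norm_one_re_lt_one_norm_sub_lt hI (half_pos hε)
  have hφx' : φ x = 1 := by
    have h1 : ‖φ x‖ ≤ 1 := (φ.le_opNorm x).trans (by rw [hφ, h.1, one_mul])
    have h2 : RCLike.re (φ x) = ‖φ x‖ := le_antisymm (RCLike.re_le_norm _) (by linarith)
    rw [← RCLike.re_eq_self_of_le h2.ge, hφx, RCLike.ofReal_one]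
  have hcφ : ‖c • φ‖ = 1 := by rw [norm_smul, hc, hφ, one_mul]
  have hcφ0 : c • φ ≠ 0 := by rintro h0; simp [h0] at hcφ
  -- Since `φ x = 1`, the slice where `Re (c φ)` exceeds `Re c` misses `x`; as `c` is close to 1, it
  -- lies inside the given slice.
  refine SupDistEqTwo.mono h.1.le (h.2 (gtSlice (c • φ) (RCLike.re c)) ?_ ?_) ?_ fun y hy => hy.1
  · exact isBallSlice_gtSlice hcφ0 (by rwa [hcφ])
  · rintro ⟨-, h2⟩
    simp [hφx'] at h2
  · rintro y ⟨hy1, hy2⟩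
    refine ⟨hy1, ?_⟩
    have h3 : φ y = c * φ y - (c - 1) * φ y := by ring
    have h4 : RCLike.re ((c - 1) * φ y) ≤ ε / 2 := by
      refine (RCLike.re_le_norm _).trans ?_
      rw [norm_mul]
      have : ‖φ y‖ ≤ 1 := (φ.le_opNorm y).trans (by rw [hφ, one_mul]; exact hy1)
      nlinarith [norm_nonneg (φ y), norm_nonneg (c - 1)]
    have h5 : RCLike.re c < RCLike.re (c * φ y) := hy2
    rw [h3, map_sub]
    linarith

end Basics

/-! ### Transfer of diametral points between a space and an ℓ_∞-summand. -/

section MSummand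

variable {𝕜 : Type*} [RCLike 𝕜] {E : Type*} [NormedAddCommGroup E] [NormedSpace 𝕜 E]
  {Z : Type*} [NormedAddCommGroup Z] [NormedSpace 𝕜 Z]

/-- `P : E → Z` and its right inverse `J` exhibit `Z` as an `ℓ_∞`-summand (M-summand) of `E`. -/
structure IsMSummand (P : E →L[𝕜] Z) (J : Z →L[𝕜] E) : Prop where
  proj_inj : ∀ u, P (J u) = u
  norm_proj_le : ∀ g, ‖P g‖ ≤ ‖g‖
  norm_compl_le : ∀ g, ‖g - J (P g)‖ ≤ ‖g‖
  norm_le : ∀ u g, ‖J u + (g - J (P g))‖ ≤ max ‖u‖ ‖g - J (P g)‖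

theorem nontrivial_of_norm_eq_one {x : Z} (hx : ‖x‖ = 1) : Nontrivial Z :=
  ⟨x, 0, by rintro rfl; simp at hx⟩

namespace IsMSummand

variable {P : E →L[𝕜] Z} {J : Z →L[𝕜] E} (h : IsMSummand P J)
include h

theorem norm_inj (u : Z) : ‖J u‖ = ‖u‖ := by
  refine le_antisymm ?_ ?_
  · simpa using h.norm_le u 0
  · simpa [h.proj_inj] using h.norm_proj_le (J u)

theorem norm_add_compl_le {u : Z} {g : E} (hu : ‖u‖ ≤ 1) (hg : ‖g‖ ≤ 1) :
    ‖J u + (g - J (P g))‖ ≤ 1 :=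
  (h.norm_le u g).trans (max_le hu ((h.norm_compl_le g).trans hg))

theorem proj_add_compl (u : Z) (g : E) : P (J u + (g - J (P g))) = u := by
  simp [h.proj_inj]

theorem norm_comp_proj (ψ : StrongDual 𝕜 Z) : ‖ψ.comp P‖ = ‖ψ‖ := by
  refine le_antisymm (ContinuousLinearMap.opNorm_le_bound _ (norm_nonneg _) fun g => ?_)
    (ContinuousLinearMap.opNorm_le_bound _ (norm_nonneg _) fun u => ?_)
  · exact (ψ.le_opNorm _).trans (mul_le_mul_of_nonneg_left (h.norm_proj_le g) (norm_nonneg _))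
  · simpa [h.proj_inj, h.norm_inj] using (ψ.comp P).le_opNorm (J u)

theorem isBallSlice_preimage {S : Set Z} (hS : IsBallSlice 𝕜 S) :
    IsBallSlice 𝕜 {g : E | ‖g‖ ≤ 1 ∧ P g ∈ S} := by
  obtain ⟨ψ, ε, h1, h2, hS⟩ := hS.exists_mem_iff
  refine isBallSlice_of_mem_iff (φ := ψ.comp P) (by rw [h.norm_comp_proj, h1]) h2 fun g => ?_
  simp only [Set.mem_ofPred_eq, hS, ContinuousLinearMap.comp_apply]
  exact ⟨fun hg => ⟨hg.1, hg.2.2⟩, fun hg => ⟨hg.1, (h.norm_proj_le g).trans hg.1, hg.2⟩⟩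

/-- Freeze the complementary component of `g` and vary only the part in `Z`: the slice condition
becomes a lower bound on `Re (φ ∘ J)`. If `φ ∘ J = 0` that bound is vacuous on the ball, and any
slice containing `P g` serves. -/
theorem exists_isBallSlice_subset_image [Nontrivial Z] {S : Set E} (hS : IsBallSlice 𝕜 S)
    {g : E} (hg : g ∈ S) :
    ∃ S' : Set Z, IsBallSlice 𝕜 S' ∧ P g ∈ S' ∧ ∀ u ∈ S', ∃ w ∈ S, P w = u := by
  obtain ⟨φ, ε, h1, h2, hS⟩ := hS.exists_mem_iff
  obtain ⟨hg1, hg2⟩ := (hS g).1 hg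
  have hPg : ‖P g‖ ≤ 1 := (h.norm_proj_le g).trans hg1
  set r : ℝ := 1 - ε - RCLike.re (φ (g - J (P g))) with hr
  have hlift : ∀ u : Z, ‖u‖ ≤ 1 → r < RCLike.re ((φ.comp J) u) → ∃ w ∈ S, P w = u := by
    intro u hu hru
    refine ⟨J u + (g - J (P g)), (hS _).2 ⟨h.norm_add_compl_le hu hg1, ?_⟩,
      h.proj_add_compl u g⟩
    rw [map_add, map_add]
    rw [ContinuousLinearMap.comp_apply] at hru
    linarith
  have hrg : r < RCLike.re ((φ.comp J) (P g)) := by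
    rw [hr, ContinuousLinearMap.comp_apply, map_sub, map_sub]
    linarith
  by_cases hψ : φ.comp J = 0
  · obtain ⟨ξ, hξ, hξg⟩ := exists_dual_vector' 𝕜 (P g)
    refine ⟨gtSlice ξ (-1), isBallSlice_gtSlice (by rintro rfl; simp at hξ)
      (by rw [hξ]; norm_num), ⟨hPg, ?_⟩, fun u hu => hlift u hu.1 ?_⟩
    · rw [hξg, RCLike.ofReal_re]; linarith [norm_nonneg (P g)]
    · rw [hψ] at hrg ⊢
      simpa using hrg
  · exact ⟨gtSlice (φ.comp J) r, isBallSlice_gtSlice hψ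
      (hrg.trans_le (re_apply_le_norm _ hPg)), ⟨hPg, hrg⟩, fun u hu => hlift u hu.1 hu.2⟩

theorem isConvexCombSlices_preimage {C : Set Z} (hC : IsConvexCombSlices 𝕜 C) :
    ∃ C' : Set E, IsConvexCombSlices 𝕜 C' ∧ (∀ g ∈ C', P g ∈ C) ∧
      ∀ g, ‖g‖ ≤ 1 → P g ∈ C → g ∈ C' := by
  obtain ⟨n, lam, S, h0, h1, hS, rfl⟩ := hC
  refine ⟨_, ⟨n, lam, fun i => {g : E | ‖g‖ ≤ 1 ∧ P g ∈ S i}, h0, h1,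
    fun i => h.isBallSlice_preimage (hS i), rfl⟩, ?_, ?_⟩
  · rintro _ ⟨y, hy, rfl⟩
    exact ⟨fun i => P (y i), fun i => (hy i).2, by simp⟩
  · rintro g hg ⟨u, hu, hPg⟩
    -- The weights sum to 1, so giving every summand the complementary part of `g` reproduces `g`
    -- itself.
    refine ⟨fun i => J (u i) + (g - J (P g)), fun i =>
      ⟨h.norm_add_compl_le ((hS i).norm_le (hu i)) hg, by rw [h.proj_add_compl]; exact hu i⟩, ?_⟩
    simp only [smul_add, Finset.sum_add_distrib, ← Finset.sum_smul]
    rw [← RCLike.ofReal_sum, h1, RCLike.ofReal_one, one_smul]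
    simp only [← map_smul, ← map_sum]
    rw [← hPg, add_sub_cancel]

theorem exists_isConvexCombSlices_subset_image [Nontrivial Z] {C : Set E}
    (hC : IsConvexCombSlices 𝕜 C) :
    ∃ C' : Set Z, IsConvexCombSlices 𝕜 C' ∧ ∀ u ∈ C', ∃ w ∈ C, P w = u := by
  obtain ⟨n, lam, S, h0, h1, hS, rfl⟩ := hC
  choose g hg using fun i => (hS i).nonempty
  choose S' hS' hgS' hlift using fun i => h.exists_isBallSlice_subset_image (hS i) (hg i)
  refine ⟨_, ⟨n, lam, S', h0, h1, hS', rfl⟩, ?_⟩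
  rintro _ ⟨u, hu, rfl⟩
  choose w hw hwu using fun i => hlift i (u i) (hu i)
  exact ⟨_, ⟨w, hw, rfl⟩, by simp [hwu]⟩

theorem isBallWeaklyOpen_preimage {W : Set Z} (hW : IsBallWeaklyOpen 𝕜 W) :
    IsBallWeaklyOpen 𝕜 {g : E | ‖g‖ ≤ 1 ∧ P g ∈ W} := by
  obtain ⟨V, hV, rfl⟩ := hW
  refine ⟨WeakSpace.map P ⁻¹' V, hV.preimage (WeakSpace.map P).continuous, ?_⟩
  ext g
  simp only [Set.mem_ofPred_eq, mem_closedBall_zero_iff]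
  exact ⟨fun hg => ⟨hg.1, hg.2.2⟩, fun hg => ⟨hg.1, (h.norm_proj_le g).trans hg.1, hg.2⟩⟩

theorem exists_isBallWeaklyOpen_subset_image {W : Set E} (hW : IsBallWeaklyOpen 𝕜 W)
    {g : E} (hg : g ∈ W) :
    ∃ W' : Set Z, IsBallWeaklyOpen 𝕜 W' ∧ P g ∈ W' ∧ ∀ u ∈ W', ∃ w ∈ W, P w = u := by
  obtain ⟨V, hV, rfl⟩ := hW
  obtain ⟨hg1, hg2⟩ := hg
  rw [mem_closedBall_zero_iff] at hg1
  let F : WeakSpace 𝕜 Z → WeakSpace 𝕜 E := fun u =>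
    WeakSpace.map J u + toWeakSpace 𝕜 E (g - J (P g))
  have hF : Continuous F := (WeakSpace.map J).continuous.add continuous_const
  have hFu : ∀ u : Z, F (toWeakSpace 𝕜 Z u) = toWeakSpace 𝕜 E (J u + (g - J (P g))) :=
    fun u => (map_add (toWeakSpace 𝕜 E) (J u) (g - J (P g))).symm
  refine ⟨_, ⟨F ⁻¹' V, hV.preimage hF, rfl⟩, ⟨?_, ?_⟩, ?_⟩
  · simpa using (h.norm_proj_le g).trans hg1
  · rw [Set.mem_preimage, hFu, add_sub_cancel]; exact hg2
  · rintro u ⟨hu1, hu2⟩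
    rw [Set.mem_preimage, hFu] at hu2
    rw [mem_closedBall_zero_iff] at hu1
    exact ⟨_, ⟨by simpa using h.norm_add_compl_le hu1 hg1, hu2⟩, h.proj_add_compl u g⟩

section Points

variable {f : E}

theorem norm_eq_one (hf : ‖f - J (P f)‖ < 1) (hf1 : ‖f‖ = 1) : ‖P f‖ = 1 := by
  have h1 := h.norm_le (P f) f
  rw [add_sub_cancel, hf1] at h1
  refine le_antisymm (hf1 ▸ h.norm_proj_le f) ?_
  rcases le_max_iff.1 h1 with h2 | h2 <;> linarith

/-- The complementary part of `f - g` has norm at most `‖f - J (P f)‖ + 1 ≤ 2 - ε`, so a distance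
above `2 - ε` must come from the summand. -/
theorem norm_sub_le_norm_proj {g : E} (hg : ‖g‖ ≤ 1)
    {ε : ℝ} (hε : ε ≤ 1 - ‖f - J (P f)‖) (hfg : 2 - ε < ‖f - g‖) : 2 - ε < ‖P f - P g‖ := by
  have h1 := h.norm_le (P (f - g)) (f - g)
  rw [add_sub_cancel] at h1
  have h2 : ‖(f - g) - J (P (f - g))‖ ≤ ‖f - J (P f)‖ + 1 := by
    have : (f - g) - J (P (f - g)) = (f - J (P f)) - (g - J (P g)) := by
      rw [map_sub, map_sub]; abel
    rw [this]
    exact (norm_sub_le _ _).trans (by linarith [h.norm_compl_le g])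
  rw [map_sub] at h1 h2
  rcases le_max_iff.1 h1 with h3 | h3
  · linarith
  · linarith

theorem supDistEqTwo_proj (hf1 : ‖f‖ = 1) (hf : ‖f - J (P f)‖ < 1) {C : Set Z} {C' : Set E}
    (hC : ∀ u ∈ C, ‖u‖ ≤ 1) (hC' : ∀ g ∈ C', ‖g‖ ≤ 1) (hP : ∀ g ∈ C', P g ∈ C)
    (hd : SupDistEqTwo f C') : SupDistEqTwo (P f) C := by
  rw [supDistEqTwo_iff ((h.norm_proj_le f).trans hf1.le) hC]
  intro ε hε
  obtain ⟨g, hg, hfg⟩ := (supDistEqTwo_iff hf1.le hC').1 hd (min ε (1 - ‖f - J (P f)‖))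
    (lt_min hε (by linarith))
  refine ⟨P g, hP g hg, ?_⟩
  have := h.norm_sub_le_norm_proj (hC' g hg) (min_le_right _ _) hfg
  linarith [min_le_left ε (1 - ‖f - J (P f)‖)]

/-- Lifting cannot decrease distances because `P` is a contraction; no bound on the complement of
`f` is needed in this direction. -/
theorem supDistEqTwo_lift (hf1 : ‖f‖ ≤ 1) {C : Set Z} {C' : Set E}
    (hC : ∀ u ∈ C, ‖u‖ ≤ 1) (hC' : ∀ g ∈ C', ‖g‖ ≤ 1) (hP : ∀ u ∈ C, ∃ w ∈ C', P w = u)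
    (hd : SupDistEqTwo (P f) C) : SupDistEqTwo f C' := by
  rw [supDistEqTwo_iff hf1 hC']
  intro ε hε
  obtain ⟨u, hu, hfu⟩ := (supDistEqTwo_iff ((h.norm_proj_le f).trans hf1) hC).1 hd ε hε
  obtain ⟨w, hw, rfl⟩ := hP u hu
  refine ⟨w, hw, hfu.trans_le ?_⟩
  rw [← map_sub]
  exact h.norm_proj_le _

theorem isSuperDaugavetPoint_proj (hf : ‖f - J (P f)‖ < 1) (hd : IsSuperDaugavetPoint 𝕜 f) :
    IsSuperDaugavetPoint 𝕜 (P f) := by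
  refine ⟨h.norm_eq_one hf hd.1, fun W hW ⟨u, hu⟩ => ?_⟩
  refine h.supDistEqTwo_proj hd.1 hf (fun u => hW.norm_le) (fun g hg => hg.1)
    (fun g hg => hg.2) (hd.2 _ (h.isBallWeaklyOpen_preimage hW) ⟨J u, ?_⟩)
  exact ⟨(h.norm_inj u).trans_le (hW.norm_le hu), by rwa [h.proj_inj]⟩

theorem isSuperDeltaPoint_proj (hf : ‖f - J (P f)‖ < 1) (hd : IsSuperDeltaPoint 𝕜 f) :
    IsSuperDeltaPoint 𝕜 (P f) :=
  ⟨h.norm_eq_one hf hd.1, fun _ hW hfW =>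
    h.supDistEqTwo_proj hd.1 hf (fun _ => hW.norm_le) (fun _ hg => hg.1)
      (fun _ hg => hg.2) (hd.2 _ (h.isBallWeaklyOpen_preimage hW) ⟨hd.1.le, hfW⟩)⟩

theorem isCcsDaugavetPoint_proj (hf : ‖f - J (P f)‖ < 1) (hd : IsCcsDaugavetPoint 𝕜 f) :
    IsCcsDaugavetPoint 𝕜 (P f) := by
  refine ⟨h.norm_eq_one hf hd.1, fun C hC => ?_⟩
  obtain ⟨C', hC', hP, -⟩ := h.isConvexCombSlices_preimage hC
  exact h.supDistEqTwo_proj hd.1 hf (fun u => hC.norm_le) (fun g => hC'.norm_le) hP (hd.2 _ hC')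

theorem isCcsDeltaPoint_proj (hf : ‖f - J (P f)‖ < 1) (hd : IsCcsDeltaPoint 𝕜 f) :
    IsCcsDeltaPoint 𝕜 (P f) := by
  refine ⟨h.norm_eq_one hf hd.1, fun C hC hfC => ?_⟩
  obtain ⟨C', hC', hP, hfC'⟩ := h.isConvexCombSlices_preimage hC
  exact h.supDistEqTwo_proj hd.1 hf (fun u => hC.norm_le) (fun g => hC'.norm_le) hP
    (hd.2 _ hC' (hfC' f hd.1.le hfC))

theorem isDaugavetPoint_proj (hf : ‖f - J (P f)‖ < 1) (hd : IsDaugavetPoint 𝕜 f) :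
    IsDaugavetPoint 𝕜 (P f) :=
  ⟨h.norm_eq_one hf hd.1, fun _ hS =>
    h.supDistEqTwo_proj hd.1 hf (fun _ => hS.norm_le) (fun _ hg => hg.1)
      (fun _ hg => hg.2) (hd.2 _ (h.isBallSlice_preimage hS))⟩

theorem isDeltaPoint_proj (hf : ‖f - J (P f)‖ < 1) (hd : IsDeltaPoint 𝕜 f) :
    IsDeltaPoint 𝕜 (P f) :=
  ⟨h.norm_eq_one hf hd.1, fun _ hS hfS =>
    h.supDistEqTwo_proj hd.1 hf (fun _ => hS.norm_le) (fun _ hg => hg.1)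
      (fun _ hg => hg.2) (hd.2 _ (h.isBallSlice_preimage hS) ⟨hd.1.le, hfS⟩)⟩

theorem isNablaPoint_proj (hf : ‖f - J (P f)‖ < 1) (hd : IsNablaPoint 𝕜 f) :
    IsNablaPoint 𝕜 (P f) :=
  ⟨h.norm_eq_one hf hd.1, fun _ hS hfS =>
    h.supDistEqTwo_proj hd.1 hf (fun _ => hS.norm_le) (fun _ hg => hg.1)
      (fun _ hg => hg.2) (hd.2 _ (h.isBallSlice_preimage hS) fun hf' => hfS hf'.2)⟩

theorem isSuperDaugavetPoint_lift (hf1 : ‖f‖ = 1) (hd : IsSuperDaugavetPoint 𝕜 (P f)) :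
    IsSuperDaugavetPoint 𝕜 f := by
  refine ⟨hf1, fun W hW ⟨g, hg⟩ => ?_⟩
  obtain ⟨W', hW', hgW', hP⟩ := h.exists_isBallWeaklyOpen_subset_image hW hg
  exact h.supDistEqTwo_lift hf1.le (fun u => hW'.norm_le) (fun g => hW.norm_le) hP
    (hd.2 _ hW' ⟨_, hgW'⟩)

theorem isSuperDeltaPoint_lift (hf1 : ‖f‖ = 1) (hd : IsSuperDeltaPoint 𝕜 (P f)) :
    IsSuperDeltaPoint 𝕜 f := by
  refine ⟨hf1, fun W hW hfW => ?_⟩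
  obtain ⟨W', hW', hfW', hP⟩ := h.exists_isBallWeaklyOpen_subset_image hW hfW
  exact h.supDistEqTwo_lift hf1.le (fun u => hW'.norm_le) (fun g => hW.norm_le) hP
    (hd.2 _ hW' hfW')

theorem isCcsDaugavetPoint_lift (hf1 : ‖f‖ = 1) (hd : IsCcsDaugavetPoint 𝕜 (P f)) :
    IsCcsDaugavetPoint 𝕜 f := by
  have := nontrivial_of_norm_eq_one hd.1
  refine ⟨hf1, fun C hC => ?_⟩
  obtain ⟨C', hC', hP⟩ := h.exists_isConvexCombSlices_subset_image hC
  exact h.supDistEqTwo_lift hf1.le (fun u => hC'.norm_le) (fun g => hC.norm_le) hP (hd.2 _ hC')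

theorem isDaugavetPoint_lift (hf1 : ‖f‖ = 1) (hd : IsDaugavetPoint 𝕜 (P f)) :
    IsDaugavetPoint 𝕜 f := by
  have := nontrivial_of_norm_eq_one hd.1
  refine ⟨hf1, fun S hS => ?_⟩
  obtain ⟨g, hg⟩ := hS.nonempty
  obtain ⟨S', hS', -, hP⟩ := h.exists_isBallSlice_subset_image hS hg
  exact h.supDistEqTwo_lift hf1.le (fun u => hS'.norm_le) (fun g => hS.norm_le) hP (hd.2 _ hS')

theorem isDeltaPoint_lift (hf1 : ‖f‖ = 1) (hd : IsDeltaPoint 𝕜 (P f)) :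
    IsDeltaPoint 𝕜 f := by
  have := nontrivial_of_norm_eq_one hd.1
  refine ⟨hf1, fun S hS hfS => ?_⟩
  obtain ⟨S', hS', hfS', hP⟩ := h.exists_isBallSlice_subset_image hS hfS
  exact h.supDistEqTwo_lift hf1.le (fun u => hS'.norm_le) (fun g => hS.norm_le) hP
    (hd.2 _ hS' hfS')

/-- With no complement, `P` and `J` are mutually inverse isometries, so their roles can be exchanged
and the projection result applied to `J`. -/
theorem isNablaPoint_lift (hJP : ∀ g, J (P g) = g)
    (hd : IsNablaPoint 𝕜 (P f)) : IsNablaPoint 𝕜 f := by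
  have h' : IsMSummand J P := by
    refine ⟨hJP, fun u => (h.norm_inj u).le, fun u => ?_, fun g u => ?_⟩
    · simp [h.proj_inj]
    · simpa [h.proj_inj] using h.norm_proj_le g
  simpa [hJP] using h'.isNablaPoint_proj (f := P f) (by simp [h.proj_inj]) hd

/-- If the complement of an M-summand is nontrivial, then a `∇` point whose complementary
component is not of full norm is a Daugavet point. -/
theorem isDaugavetPoint_of_isNablaPoint (hf : ‖f - J (P f)‖ < 1) {w : E} (hw : w ≠ 0)
    (hPw : P w = 0) (hd : IsNablaPoint 𝕜 f) : IsDaugavetPoint 𝕜 f := by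
  refine hd.isDaugavetPoint_of_forall fun φ hφ hφf ε hε => ?_
  have hf1 := hd.1
  obtain ⟨η, hη, hηw⟩ := exists_dual_vector 𝕜 w (norm_ne_zero_iff.2 hw)
  set y := f - J (P f) with hy
  have hPf : ‖P f‖ = 1 := h.norm_eq_one hf hf1
  have hJz : RCLike.re (φ (J (P f))) ≤ 1 :=
    hφ ▸ re_apply_le_norm φ (by rw [h.norm_inj, hPf])
  have hsum : RCLike.re (φ (J (P f))) + RCLike.re (φ y) = 1 := by
    rw [← hφf, hy, map_sub, map_sub]; ring
  -- Stretching `y` to norm 1 keeps the vector in the ball. As `φ` already norms `f`, a positive `Re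
  -- φ y` would push the value beyond `‖φ‖ = 1`.
  have hφy : RCLike.re (φ y) = 0 := by
    by_cases hy0 : y = 0
    · simp [hy0]
    have hypos : 0 < ‖y‖ := norm_pos_iff.2 hy0
    have h0 : 0 ≤ RCLike.re (φ y) := by linarith
    set c : 𝕜 := ((‖y‖⁻¹ : ℝ) : 𝕜) with hc
    have hJy : J (P (c • y)) = 0 := by
      rw [map_smul, hy, map_sub, h.proj_inj, sub_self, smul_zero, map_zero]
    have hcy : ‖c • y‖ = 1 := by
      rw [norm_smul, hc, RCLike.norm_ofReal, abs_of_pos (inv_pos.2 hypos),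
        inv_mul_cancel₀ hypos.ne']
    have h1 := h.norm_add_compl_le hPf.le hcy.le
    rw [hJy, sub_zero] at h1
    have h2 := re_apply_le_norm φ h1
    rw [hφ, map_add, map_add, map_smul, smul_eq_mul, hc, RCLike.re_ofReal_mul] at h2
    have h3 : 1 < ‖y‖⁻¹ := (one_lt_inv₀ hypos).2 hf
    nlinarith
  set δ : ℝ := min (1 / 2) (ε / 8) with hδ
  have hδ0 : 0 < δ := lt_min (by norm_num) (by linarith)
  have hδ1 : δ ≤ 1 / 2 := min_le_left _ _
  have hδ2 : δ ≤ ε / 8 := min_le_right _ _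
  -- The mixture has norm 1 because `η` norms `w` in the complement, yet it does not norm `f`
  -- because `‖y‖ < 1`. Its slice at height `Re (φ' f)` therefore misses `f`, and the ∇ property
  -- applies.
  let φ' : StrongDual 𝕜 E := ((1 - δ : ℝ) : 𝕜) • φ.comp (J.comp P) +
    ((δ : ℝ) : 𝕜) • η.comp (ContinuousLinearMap.id 𝕜 E - J.comp P)
  have hφ' : ∀ g, φ' g = ((1 - δ : ℝ) : 𝕜) * φ (J (P g)) + (δ : 𝕜) * η (g - J (P g)) :=
    fun g => rfl
  have hreφ' : ∀ g, RCLike.re (φ' g) =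
      (1 - δ) * RCLike.re (φ (J (P g))) + δ * RCLike.re (η (g - J (P g))) := fun g => by
    rw [hφ', map_add, RCLike.re_ofReal_mul, RCLike.re_ofReal_mul]
  have hle : ‖φ'‖ ≤ 1 := by
    refine ContinuousLinearMap.opNorm_le_bound _ zero_le_one fun g => ?_
    have h1 : ‖φ (J (P g))‖ ≤ ‖g‖ := (φ.le_opNorm _).trans
      (by rw [hφ, one_mul, h.norm_inj]; exact h.norm_proj_le g)
    have h2 : ‖η (g - J (P g))‖ ≤ ‖g‖ := (η.le_opNorm _).trans
      (by rw [hη, one_mul]; exact h.norm_compl_le g)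
    rw [hφ']
    refine (norm_add_le _ _).trans ?_
    rw [norm_mul, norm_mul, RCLike.norm_ofReal, RCLike.norm_ofReal, abs_of_pos hδ0,
      abs_of_nonneg (by linarith)]
    nlinarith
  have hφ'1 : ‖φ'‖ = 1 := by
    refine le_antisymm hle ?_
    have hwpos : 0 < ‖w‖ := norm_pos_iff.2 hw
    set w' : E := ((‖w‖⁻¹ : ℝ) : 𝕜) • w with hw'
    have hPw' : P w' = 0 := by rw [hw', map_smul, hPw, smul_zero]
    have hw'1 : ‖w'‖ = 1 := by
      rw [hw', norm_smul, RCLike.norm_ofReal, abs_of_pos (inv_pos.2 hwpos),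
        inv_mul_cancel₀ hwpos.ne']
    have h1 := h.norm_add_compl_le hPf.le hw'1.le
    have h2 := re_apply_le_norm φ' h1
    rw [hreφ', h.proj_add_compl, add_sub_cancel_left, hPw', map_zero, sub_zero, hw', map_smul,
      smul_eq_mul, RCLike.re_ofReal_mul, hηw, RCLike.ofReal_re, inv_mul_cancel₀ hwpos.ne'] at h2
    have h3 : RCLike.re (φ (J (P f))) = 1 := by linarith
    rw [h3] at h2
    linarith
  have hηy : RCLike.re (η y) < 1 := by
    refine (RCLike.re_le_norm _).trans_lt ((η.le_opNorm _).trans_lt ?_)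
    rwa [hη, one_mul]
  have hηy' : -1 < RCLike.re (η y) := by
    have h1 : ‖η y‖ < 1 := (η.le_opNorm _).trans_lt (by rwa [hη, one_mul])
    linarith [(abs_le.1 (RCLike.abs_re_le_norm (η y))).1]
  have hre : RCLike.re (φ' f) = 1 - δ + δ * RCLike.re (η y) := by
    rw [hreφ', ← hy]
    have : RCLike.re (φ (J (P f))) = 1 := by linarith
    rw [this]; ring
  have hfar := hd.2 (gtSlice φ' (RCLike.re (φ' f)))
    (isBallSlice_gtSlice (by intro h0; rw [h0, norm_zero] at hφ'1; norm_num at hφ'1)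
      (by rw [hφ'1, hre]; nlinarith)) (fun hmem => lt_irrefl _ hmem.2)
  rw [supDistEqTwo_iff hf1.le fun g hg => hg.1] at hfar ⊢
  intro ε' hε'
  obtain ⟨g, ⟨hg1, hg2⟩, hfg⟩ := hfar (min ε' (1 - ‖y‖)) (lt_min hε' (by linarith))
  have h4 := h.norm_sub_le_norm_proj hg1 (min_le_right _ _) hfg
  -- Only the summand part of `g` is kept: it carries the large distance and nearly norms `φ`, while
  -- `y` contributes nothing to `Re φ`.
  refine ⟨J (P g) + y, ⟨h.norm_add_compl_le ((h.norm_proj_le g).trans hg1) hf1.le, ?_⟩, ?_⟩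
  · rw [map_add, map_add, hφy, add_zero]
    rw [hre, hreφ'] at hg2
    have h5 : RCLike.re (η (g - J (P g))) ≤ 1 :=
      hη ▸ re_apply_le_norm η ((h.norm_compl_le g).trans hg1)
    have h6 : (1 - δ) * RCLike.re (φ (J (P g))) > 1 - 3 * δ := by nlinarith
    have h7 : RCLike.re (φ (J (P g))) > 1 - 8 * δ := by
      by_contra! hcon
      nlinarith
    linarith
  · have h5 : P (f - (J (P g) + y)) = P f - P g := by
      rw [map_sub, h.proj_add_compl]
    have h6 := h.norm_proj_le (f - (J (P g) + y))
    rw [h5] at h6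
    linarith [min_le_left ε' (1 - ‖y‖)]

end Points

end IsMSummand

end MSummand

theorem exists_pos_le_one_forall_le {ι : Type*} [Finite ι] {η : ι → ℝ} (hη : ∀ k, 0 < η k) :
    ∃ r > 0, r ≤ 1 ∧ ∀ k, r ≤ η k := by
  rcases isEmpty_or_nonempty ι with he | hne
  · exact ⟨1, one_pos, le_rfl, fun k => he.elim k⟩
  · obtain ⟨k, hk⟩ := Finite.exists_min η
    exact ⟨min 1 (η k), lt_min one_pos (hη k), min_le_left _ _,
      fun j => (min_le_right _ _).trans (hk j)⟩

/-! ### Finite ℓ_∞-sums of copies of `X`. -/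

section PiSpace

variable {𝕜 : Type*} [RCLike 𝕜] {ι : Type*} [Fintype ι]
  {X : Type*} [NormedAddCommGroup X] [NormedSpace 𝕜 X]

theorem isMSummand_proj_single [DecidableEq ι] (t : ι) :
    IsMSummand (ContinuousLinearMap.proj (R := 𝕜) (φ := fun _ : ι => X) t)
      (ContinuousLinearMap.single 𝕜 (fun _ : ι => X) t) := by
  refine ⟨fun u => by simp, fun g => norm_le_pi_norm g t, fun g => ?_, fun u g => ?_⟩
  · refine (pi_norm_le_iff_of_nonneg (norm_nonneg _)).2 fun s => ?_
    rcases eq_or_ne s t with rfl | hst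
    · simp
    · simpa [Pi.single_eq_of_ne hst] using norm_le_pi_norm g s
  · refine (pi_norm_le_iff_of_nonneg (by positivity)).2 fun s => ?_
    rcases eq_or_ne s t with rfl | hst
    · simp
    · have := norm_le_pi_norm (g - Pi.single t (g t)) s
      simp only [Pi.sub_apply, Pi.single_eq_of_ne hst, sub_zero] at this
      simpa [Pi.single_eq_of_ne hst] using Or.inr this

/-- Products of slices of the factors contain slices of the `ℓ_∞`-sum. -/
theorem exists_functional_pi [Nonempty ι] (ψ : ι → StrongDual 𝕜 X) (hψ : ∀ k, ‖ψ k‖ = 1)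
    (ε : ι → ℝ) (hε : ∀ k, 0 < ε k) :
    ∃ (φ : StrongDual 𝕜 (ι → X)) (ε₀ : ℝ), ‖φ‖ = 1 ∧ 0 < ε₀ ∧
      (∀ u : ι → X, ‖u‖ ≤ 1 → 1 - ε₀ < RCLike.re (φ u) →
        ∀ k, 1 - ε k < RCLike.re (ψ k (u k))) ∧
      ∀ u : ι → X, ∑ k, (1 - RCLike.re (ψ k (u k))) / ε k < 1 → 1 - ε₀ < RCLike.re (φ u) := by
  -- The weights are proportional to 1/ε_k. Then `1 - Re φ u` is 1/C times the sum of the relative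
  -- deficits (1 - Re ψ_k u_k)/ε_k; on the ball these are nonnegative, so a sum below 1 forces each
  -- one below 1.
  set C : ℝ := ∑ k, 1 / ε k with hC
  have hCpos : 0 < C := Finset.sum_pos (fun k _ => one_div_pos.2 (hε k)) Finset.univ_nonempty
  let φ : StrongDual 𝕜 (ι → X) :=
    ∑ k, ((1 / ε k / C : ℝ) : 𝕜) • (ψ k).comp (ContinuousLinearMap.proj k)
  have hφ : ∀ u, φ u = ∑ k, ((1 / ε k / C : ℝ) : 𝕜) * ψ k (u k) := fun u => by
    simp [φ, sum_apply]
  have hreφ : ∀ u, RCLike.re (φ u) = ∑ k, 1 / ε k / C * RCLike.re (ψ k (u k)) := fun u => by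
    rw [hφ, map_sum]
    exact Finset.sum_congr rfl fun k _ => RCLike.re_ofReal_mul _ _
  have hsum1 : ∑ k, 1 / ε k / C = 1 := by rw [← Finset.sum_div, div_self hCpos.ne']
  have hcpos : ∀ k, 0 < 1 / ε k / C := fun k => div_pos (one_div_pos.2 (hε k)) hCpos
  have hre' : ∀ u, RCLike.re (φ u) = 1 - (∑ k, (1 - RCLike.re (ψ k (u k))) / ε k) / C := by
    intro u
    have h1 : ∑ k, 1 / ε k / C * RCLike.re (ψ k (u k)) =
        ∑ k, (1 / ε k / C - (1 - RCLike.re (ψ k (u k))) / ε k / C) :=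
      Finset.sum_congr rfl fun k _ => by ring
    rw [hreφ, h1, Finset.sum_sub_distrib, hsum1, Finset.sum_div]
  have hnorm : ‖φ‖ = 1 := by
    refine le_antisymm ?_ (le_of_forall_lt fun r hr => ?_)
    · refine ContinuousLinearMap.opNorm_le_bound _ zero_le_one fun u => ?_
      rw [hφ, one_mul]
      calc _ ≤ ∑ k, 1 / ε k / C * ‖u‖ := norm_sum_le_of_le _ fun k _ => by
            rw [norm_mul, RCLike.norm_ofReal, abs_of_pos (hcpos k)]
            refine mul_le_mul_of_nonneg_left ?_ (hcpos k).le
            exact ((ψ k).le_opNorm _).trans (by rw [hψ, one_mul]; exact norm_le_pi_norm u k)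
        _ = ‖u‖ := by rw [← Finset.sum_mul, hsum1, one_mul]
    · choose u hu hru using fun k => exists_re_apply_gt (ψ k) (r := r) (by rwa [hψ])
      refine lt_of_lt_of_le ?_ (re_apply_le_norm φ ((pi_norm_le_iff_of_nonneg zero_le_one).2 hu))
      rw [hreφ]
      calc r = ∑ k, 1 / ε k / C * r := by rw [← Finset.sum_mul, hsum1, one_mul]
        _ < _ := Finset.sum_lt_sum_of_nonempty Finset.univ_nonempty fun k _ =>
          mul_lt_mul_of_pos_left (hru k) (hcpos k)
  refine ⟨φ, 1 / C, hnorm, one_div_pos.2 hCpos, fun u hu h k => ?_, fun u h => ?_⟩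
  · rw [hre', sub_lt_sub_iff_left, div_lt_div_iff_of_pos_right hCpos] at h
    have h1 : (1 - RCLike.re (ψ k (u k))) / ε k < 1 := by
      refine lt_of_le_of_lt ?_ h
      refine Finset.single_le_sum (f := fun k => (1 - RCLike.re (ψ k (u k))) / ε k)
        (fun j _ => div_nonneg ?_ (hε j).le) (Finset.mem_univ k)
      have := re_apply_le_norm (ψ j) ((norm_le_pi_norm u j).trans hu)
      rw [hψ] at this
      linarith
    rw [div_lt_one (hε k)] at h1
    linarith
  · rw [hre', sub_lt_sub_iff_left, div_lt_div_iff_of_pos_right hCpos]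
    exact h

theorem not_supDistEqTwo_pi {z : ι → X} (hz : ‖z‖ ≤ 1) {S : Set (ι → X)}
    (hS : ∀ u ∈ S, ‖u‖ ≤ 1) {η : ι → ℝ} (hη : ∀ k, 0 < η k)
    (h : ∀ u ∈ S, ∀ k, ‖z k - u k‖ ≤ 2 - η k) : ¬ SupDistEqTwo z S := by
  intro hd
  obtain ⟨r, hr0, hr1, hr⟩ := exists_pos_le_one_forall_le hη
  obtain ⟨u, hu, hzu⟩ := (supDistEqTwo_iff hz hS).1 hd r hr0
  refine hzu.not_ge ((pi_norm_le_iff_of_nonneg (by linarith)).2 fun k => ?_)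
  rw [Pi.sub_apply]
  linarith [h u hu k, hr k]

theorem exists_slice_of_not_supDistEqTwo {E : Type*} [NormedAddCommGroup E] [NormedSpace 𝕜 E]
    {x : E} (hx : ‖x‖ = 1) {S : Set E} (hS : IsBallSlice 𝕜 S) (h : ¬ SupDistEqTwo x S) :
    ∃ (ψ : StrongDual 𝕜 E) (ε η : ℝ), ‖ψ‖ = 1 ∧ 0 < ε ∧ 0 < η ∧
      (∀ u, ‖u‖ ≤ 1 → 1 - ε < RCLike.re (ψ u) → ‖x - u‖ ≤ 2 - η) ∧
      ∀ u, u ∈ S ↔ ‖u‖ ≤ 1 ∧ 1 - ε < RCLike.re (ψ u) := by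
  rw [supDistEqTwo_iff hx.le fun y => hS.norm_le] at h
  push Not at h
  obtain ⟨η, hη, h⟩ := h
  obtain ⟨ψ, ε, h1, h2, h3⟩ := hS.exists_mem_iff
  exact ⟨ψ, ε, η, h1, h2, hη, fun u hu1 hu2 => h u ((h3 u).2 ⟨hu1, hu2⟩), h3⟩

theorem isBallSlice_gtSlice_of_norm_eq_one {E : Type*} [NormedAddCommGroup E] [NormedSpace 𝕜 E]
    {φ : StrongDual 𝕜 E} {ε : ℝ} (hφ : ‖φ‖ = 1) (hε : 0 < ε) :
    IsBallSlice 𝕜 (gtSlice φ (1 - ε)) :=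
  isBallSlice_of_mem_iff hφ hε fun _ => Iff.rfl

theorem apply_eq_sum_single [DecidableEq ι] (φ : StrongDual 𝕜 (ι → X)) (u : ι → X) :
    φ u = ∑ k, φ.comp (ContinuousLinearMap.single 𝕜 (fun _ : ι => X) k) (u k) := by
  conv_lhs => rw [← Finset.univ_sum_single u]
  rw [map_sum]
  rfl

variable [Nonempty ι] {z : ι → X}

theorem pi_norm_eq_one (hz : ∀ k, ‖z k‖ = 1) : ‖z‖ = 1 :=
  le_antisymm ((pi_norm_le_iff_of_nonneg zero_le_one).2 fun k => (hz k).le)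
    ((hz (Classical.arbitrary ι)).symm.trans_le (norm_le_pi_norm z _))

theorem exists_isDaugavetPoint_apply (hz : ∀ k, ‖z k‖ = 1) (h : IsDaugavetPoint 𝕜 z) :
    ∃ k, IsDaugavetPoint 𝕜 (z k) := by
  by_contra! hcon
  have : ∀ k, ∃ (ψ : StrongDual 𝕜 X) (ε η : ℝ), ‖ψ‖ = 1 ∧ 0 < ε ∧ 0 < η ∧
      ∀ u, ‖u‖ ≤ 1 → 1 - ε < RCLike.re (ψ u) → ‖z k - u‖ ≤ 2 - η := by
    intro k
    have h1 := hcon k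
    simp only [IsDaugavetPoint, hz k, true_and] at h1
    push Not at h1
    obtain ⟨S, hS, h2⟩ := h1
    obtain ⟨ψ, ε, η, h3, h4, h5, h6, -⟩ := exists_slice_of_not_supDistEqTwo (hz k) hS h2
    exact ⟨ψ, ε, η, h3, h4, h5, h6⟩
  choose ψ ε η hψ hε hη hfar using this
  obtain ⟨φ, ε₀, hφ, hε₀, h1, -⟩ := exists_functional_pi ψ hψ ε hε
  exact not_supDistEqTwo_pi h.1.le (fun u hu => hu.1) hη
    (fun u hu k => hfar k _ ((norm_le_pi_norm u k).trans hu.1) (h1 u hu.1 hu.2 k))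
    (h.2 _ (isBallSlice_gtSlice_of_norm_eq_one hφ hε₀))

/-- At coordinate `i` take a bad slice that misses `z i`, and elsewhere any slice witnessing failure
of Daugavet. A slice inside their product misses `z` and stays away from it in every coordinate. -/
theorem isNablaPoint_apply (hz : ∀ k, ‖z k‖ = 1) (h : IsNablaPoint 𝕜 z)
    (hD : ¬ ∃ k, IsDaugavetPoint 𝕜 (z k)) (i : ι) : IsNablaPoint 𝕜 (z i) := by
  by_contra hcon
  have : ∀ k, ∃ (ψ : StrongDual 𝕜 X) (ε η : ℝ), ‖ψ‖ = 1 ∧ 0 < ε ∧ 0 < η ∧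
      (∀ u, ‖u‖ ≤ 1 → 1 - ε < RCLike.re (ψ u) → ‖z k - u‖ ≤ 2 - η) ∧
      (k = i → RCLike.re (ψ (z k)) ≤ 1 - ε) := by
    intro k
    by_cases hk : k = i
    · subst hk
      simp only [IsNablaPoint, hz k, true_and] at hcon
      push Not at hcon
      obtain ⟨S, hS, hxS, h2⟩ := hcon
      obtain ⟨ψ, ε, η, h3, h4, h5, h6, h7⟩ := exists_slice_of_not_supDistEqTwo (hz k) hS h2
      exact ⟨ψ, ε, η, h3, h4, h5, h6, fun _ =>
        not_lt.1 fun h8 => hxS ((h7 _).2 ⟨(hz k).le, h8⟩)⟩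
    · have h1 := not_exists.1 hD k
      simp only [IsDaugavetPoint, hz k, true_and] at h1
      push Not at h1
      obtain ⟨S, hS, h2⟩ := h1
      obtain ⟨ψ, ε, η, h3, h4, h5, h6, -⟩ := exists_slice_of_not_supDistEqTwo (hz k) hS h2
      exact ⟨ψ, ε, η, h3, h4, h5, h6, fun h => absurd h hk⟩
  choose ψ ε η hψ hε hη hfar hi using this
  obtain ⟨φ, ε₀, hφ, hε₀, h1, -⟩ := exists_functional_pi ψ hψ ε hε
  exact not_supDistEqTwo_pi h.1.le (fun u hu => hu.1) hη
    (fun u hu k => hfar k _ ((norm_le_pi_norm u k).trans hu.1) (h1 u hu.1 hu.2 k))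
    (h.2 _ (isBallSlice_gtSlice_of_norm_eq_one hφ hε₀)
      fun hmem => (hi i rfl).not_gt (h1 z hmem.1 hmem.2 i))

theorem exists_isDeltaPPoint_apply (hz : ∀ k, ‖z k‖ = 1) (h : IsDeltaPoint 𝕜 z)
    {p : ι → ℝ} (hp : ∀ k, 1 < p k) (hp1 : ∑ k, 1 / p k = 1) :
    ∃ k, IsDeltaPPoint 𝕜 (p k) (z k) := by
  by_contra! hcon
  have : ∀ k, ∃ (ψ : StrongDual 𝕜 X) (α η : ℝ), ‖ψ‖ = 1 ∧ 0 < α ∧ 0 < η ∧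
      1 - α < RCLike.re (ψ (z k)) ∧
      ∀ u, ‖u‖ ≤ 1 → 1 - p k * α < RCLike.re (ψ u) → ‖z k - u‖ ≤ 2 - η := by
    intro k
    have h1 := hcon k
    simp only [IsDeltaPPoint, hz k, true_and] at h1
    push Not at h1
    obtain ⟨ψ, α, η, h3, h4, h5, h6, h7⟩ := h1
    rw [mem_slice_closedBall, h3] at h6
    refine ⟨ψ, α, η, h3, h4, h5, h6.2, fun u hu1 hu2 => (h7 u ?_).le⟩
    rw [mem_slice_closedBall, h3]
    exact ⟨hu1, hu2⟩
  choose ψ α η hψ hα hη hzα hfar using this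
  have hp0 : ∀ k, 0 < p k := fun k => one_pos.trans (hp k)
  -- With widths p_k α_k, the relative deficit of `z k` is below 1/p_k. These sum to less than 1, so
  -- `z` itself lies in the resulting slice.
  obtain ⟨φ, ε₀, hφ, hε₀, h1, h2⟩ := exists_functional_pi ψ hψ (fun k => p k * α k)
    fun k => mul_pos (hp0 k) (hα k)
  refine not_supDistEqTwo_pi h.1.le (fun u hu => hu.1) hη
    (fun u hu k => hfar k _ ((norm_le_pi_norm u k).trans hu.1) (h1 u hu.1 hu.2 k))
    (h.2 _ (isBallSlice_gtSlice_of_norm_eq_one hφ hε₀) ⟨h.1.le, h2 z ?_⟩)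
  calc _ < ∑ k, 1 / p k := Finset.sum_lt_sum_of_nonempty Finset.univ_nonempty fun k _ => by
        rw [div_lt_div_iff₀ (mul_pos (hp0 k) (hα k)) (hp0 k)]
        nlinarith [hzα k, hp0 k]
    _ = 1 := hp1

variable [DecidableEq ι]

theorem sum_norm_comp_single (φ : StrongDual 𝕜 (ι → X)) :
    ∑ k, ‖φ.comp (ContinuousLinearMap.single 𝕜 (fun _ : ι => X) k)‖ = ‖φ‖ := by
  refine le_antisymm (le_of_forall_pos_le_add fun ε hε => ?_)
    (ContinuousLinearMap.opNorm_le_bound _ (Finset.sum_nonneg fun k _ => norm_nonneg _)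
      fun u => ?_)
  · have hcard : (0 : ℝ) < Fintype.card ι := by exact_mod_cast Fintype.card_pos
    choose u hu hur using fun k => exists_re_apply_gt
      (φ.comp (ContinuousLinearMap.single 𝕜 (fun _ : ι => X) k))
      (sub_lt_self _ (div_pos hε hcard))
    have h1 := re_apply_le_norm φ ((pi_norm_le_iff_of_nonneg zero_le_one).2 hu)
    rw [apply_eq_sum_single, map_sum] at h1
    have h2 := (Finset.sum_lt_sum_of_nonempty Finset.univ_nonempty fun k _ => hur k).le.trans h1
    rw [Finset.sum_sub_distrib, Finset.sum_const, Finset.card_univ, nsmul_eq_mul,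
      mul_div_cancel₀ _ hcard.ne'] at h2
    linarith
  · rw [apply_eq_sum_single, Finset.sum_mul]
    refine norm_sum_le_of_le _ fun k _ => (ContinuousLinearMap.le_opNorm _ _).trans ?_
    exact mul_le_mul_of_nonneg_left (norm_le_pi_norm u k) (norm_nonneg _)

/-- A coordinate that `φ` ignores can be overwritten by `-z k` without leaving the slice, giving
distance 2. -/
theorem supDistEqTwo_of_comp_single_eq_zero (hz : ∀ k, ‖z k‖ = 1) {φ : StrongDual 𝕜 (ι → X)}
    {S : Set (ι → X)} (hS : IsBallSlice 𝕜 S)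
    {r : ℝ} (hφS : ∀ u, u ∈ S ↔ ‖u‖ ≤ 1 ∧ r < RCLike.re (φ u)) {k : ι}
    (hk : φ.comp (ContinuousLinearMap.single 𝕜 (fun _ : ι => X) k) = 0) : SupDistEqTwo z S := by
  rw [supDistEqTwo_iff (pi_norm_eq_one hz).le fun u => hS.norm_le]
  intro ε hε
  obtain ⟨g, hg⟩ := hS.nonempty
  obtain ⟨hg1, hg2⟩ := (hφS g).1 hg
  refine ⟨Function.update g k (-z k), (hφS _).2 ⟨?_, ?_⟩, ?_⟩
  · refine (pi_norm_le_iff_of_nonneg zero_le_one).2 fun j => ?_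
    rcases eq_or_ne j k with rfl | hj
    · simp [hz]
    · rw [Function.update_of_ne hj]; exact (norm_le_pi_norm g j).trans hg1
  · convert! hg2 using 2
    rw [apply_eq_sum_single, apply_eq_sum_single φ g]
    refine Finset.sum_congr rfl fun j _ => ?_
    rcases eq_or_ne j k with rfl | hj
    · simp [hk]
    · rw [Function.update_of_ne hj]
  · refine lt_of_lt_of_le ?_ (norm_le_pi_norm _ k)
    rw [Pi.sub_apply, Function.update_self, sub_neg_eq_add, ← two_smul 𝕜, norm_smul, hz,
      RCLike.norm_ofNat]
    linarith

theorem isNablaPoint_pi (h : ∀ k, IsNablaPoint 𝕜 (z k)) : IsNablaPoint 𝕜 z := by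
  have hz := fun k => (h k).1
  have hz1 := pi_norm_eq_one hz
  refine ⟨hz1, fun S hS hzS => ?_⟩
  obtain ⟨φ, ε, hφ, hε, hmem⟩ := hS.exists_mem_iff
  set ψ := fun k => φ.comp (ContinuousLinearMap.single 𝕜 (fun _ : ι => X) k) with hψ
  have hsum : ∑ k, ‖ψ k‖ = 1 := hφ ▸ sum_norm_comp_single φ
  have hreφ : ∀ u, RCLike.re (φ u) = ∑ k, RCLike.re (ψ k (u k)) := fun u => by
    rw [apply_eq_sum_single, map_sum]
  have hr : ∑ k, ‖ψ k‖ * (1 - ε) = 1 - ε := by rw [← Finset.sum_mul, hsum, one_mul]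
  -- Averaging: if `z` misses the slice, some coordinate misses its proportional share. The ∇
  -- property is used there, and the other coordinates are filled with points meeting their shares.
  obtain ⟨k, -, hk⟩ : ∃ k ∈ Finset.univ, RCLike.re (ψ k (z k)) ≤ ‖ψ k‖ * (1 - ε) := by
    refine Finset.exists_le_of_sum_le Finset.univ_nonempty ?_
    rw [hr, ← hreφ]
    exact not_lt.1 fun h => hzS ((hmem z).2 ⟨hz1.le, h⟩)
  by_cases hk0 : ψ k = 0
  · exact supDistEqTwo_of_comp_single_eq_zero hz hS hmem hk0
  have hpos : 0 < ‖ψ k‖ := norm_pos_iff.2 hk0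
  have hfar := (h k).2 (gtSlice (ψ k) (‖ψ k‖ * (1 - ε)))
    (isBallSlice_gtSlice hk0 (by nlinarith)) fun hx => hk.not_gt hx.2
  rw [supDistEqTwo_iff (hz k).le fun u hu => hu.1] at hfar
  rw [supDistEqTwo_iff hz1.le fun u => hS.norm_le]
  intro δ hδ
  obtain ⟨u, ⟨hu1, hu2⟩, hu3⟩ := hfar δ hδ
  have : ∀ j, ∃ v : X, ‖v‖ ≤ 1 ∧ ‖ψ j‖ * (1 - ε) ≤ RCLike.re (ψ j v) := fun j => by
    by_cases hj : ψ j = 0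
    · exact ⟨0, by simp, by simp [hj]⟩
    · obtain ⟨v, hv, hv'⟩ := exists_re_apply_gt (ψ j) (r := ‖ψ j‖ * (1 - ε))
        (by nlinarith [norm_pos_iff.2 hj])
      exact ⟨v, hv, hv'.le⟩
  choose v hv hv' using this
  refine ⟨Function.update v k u, (hmem _).2 ⟨?_, ?_⟩, ?_⟩
  · refine (pi_norm_le_iff_of_nonneg zero_le_one).2 fun j => ?_
    rcases eq_or_ne j k with rfl | hj
    · simpa using hu1
    · simpa [Function.update_of_ne hj] using hv j
  · rw [hreφ, ← hr]
    refine Finset.sum_lt_sum (fun j _ => ?_) ⟨k, Finset.mem_univ k, by simpa using hu2⟩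
    rcases eq_or_ne j k with rfl | hj
    · simpa using hu2.le
    · simpa [Function.update_of_ne hj] using hv' j
  · refine hu3.trans_le ?_
    simpa using norm_le_pi_norm (z - Function.update v k u) k

theorem IsDeltaPPoint.exists_of_ne_zero {p : ℝ} {x : X} (h : IsDeltaPPoint 𝕜 p x)
    {ψ : StrongDual 𝕜 X} (hψ : ψ ≠ 0) {a ε : ℝ} (ha : 0 < a) (hε : 0 < ε)
    (hx : ‖ψ‖ - a < RCLike.re (ψ x)) :
    ∃ u, ‖u‖ ≤ 1 ∧ ‖ψ‖ - p * a < RCLike.re (ψ u) ∧ 2 - ε ≤ ‖x - u‖ := by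
  have h0 : 0 < ‖ψ‖ := norm_pos_iff.2 hψ
  have hnorm : ‖((‖ψ‖⁻¹ : ℝ) : 𝕜) • ψ‖ = 1 := by
    rw [norm_smul, RCLike.norm_ofReal, abs_of_pos (inv_pos.2 h0), inv_mul_cancel₀ h0.ne']
  have hmem : ∀ (b : ℝ) (u : X), u ∈ slice 𝕜 (Metric.closedBall 0 1)
      (((‖ψ‖⁻¹ : ℝ) : 𝕜) • ψ) (b / ‖ψ‖) ↔ ‖u‖ ≤ 1 ∧ ‖ψ‖ - b < RCLike.re (ψ u) := by
    intro b u
    rw [mem_slice_closedBall, hnorm, smul_apply, smul_eq_mul, RCLike.re_ofReal_mul,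
      ← div_eq_inv_mul, lt_div_iff₀ h0, sub_mul, one_mul, div_mul_cancel₀ _ h0.ne']
  obtain ⟨u, hu, hxu⟩ := h.2 _ (a / ‖ψ‖) ε hnorm (div_pos ha h0) hε ((hmem a x).2 ⟨h.1.le, hx⟩)
  rw [← mul_div_assoc, hmem] at hu
  exact ⟨u, hu.1, hu.2, hxu⟩

/-- Let b_k slightly exceed the deficit of `z k`, with σ = ∑ b_k < α, and put p_k = σ/b_k. The
Δ_{p_t} property lets coordinate t spend the whole budget σ, leaving `α - σ` for the small losses
when the other coordinates nearly norm. Having two coordinates ensures p_k > 1. -/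
theorem isDeltaPoint_pi (hz : ∀ k, ‖z k‖ = 1) (hcard : 2 ≤ Fintype.card ι)
    (h : ∀ p : ι → ℝ, (∀ k, 1 < p k) → ∑ k, 1 / p k = 1 → ∃ k, IsDeltaPPoint 𝕜 (p k) (z k)) :
    IsDeltaPoint 𝕜 z := by
  have hz1 := pi_norm_eq_one hz
  have hc0 : (0 : ℝ) < Fintype.card ι := by exact_mod_cast Fintype.card_pos
  refine ⟨hz1, fun S hS hzS => ?_⟩
  obtain ⟨φ, α, hφ, hα, hmem⟩ := hS.exists_mem_iff
  set ψ := fun k => φ.comp (ContinuousLinearMap.single 𝕜 (fun _ : ι => X) k) with hψ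
  have hsum : ∑ k, ‖ψ k‖ = 1 := hφ ▸ sum_norm_comp_single φ
  have hreφ : ∀ u, RCLike.re (φ u) = ∑ k, RCLike.re (ψ k (u k)) := fun u => by
    rw [apply_eq_sum_single, map_sum]
  by_cases hk0 : ∃ k, ψ k = 0
  · obtain ⟨k, hk0⟩ := hk0
    exact supDistEqTwo_of_comp_single_eq_zero hz hS hmem hk0
  push Not at hk0
  set a : ι → ℝ := fun k => ‖ψ k‖ - RCLike.re (ψ k (z k)) with ha
  have ha0 : ∀ k, 0 ≤ a k := fun k => sub_nonneg.2 (re_apply_le_norm _ (hz k).le)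
  have hasum : ∑ k, a k < α := by
    rw [ha, Finset.sum_sub_distrib, hsum, ← hreφ]
    linarith [((hmem z).1 hzS).2]
  -- Half of the slack, shared equally: every b_k becomes positive while the total stays below α.
  set s : ℝ := (α - ∑ k, a k) / 2 / Fintype.card ι with hs
  have hs0 : 0 < s := div_pos (by linarith) hc0
  set b : ι → ℝ := fun k => a k + s with hb
  have hb0 : ∀ k, 0 < b k := fun k => add_pos_of_nonneg_of_pos (ha0 k) hs0
  set σ : ℝ := ∑ k, b k with hσ
  have hσα : σ < α := by
    rw [hσ, hb, Finset.sum_add_distrib, Finset.sum_const, Finset.card_univ, nsmul_eq_mul, hs,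
      mul_div_cancel₀ _ hc0.ne']
    linarith
  have hσ0 : 0 < σ := Finset.sum_pos (fun k _ => hb0 k) Finset.univ_nonempty
  have hbσ : ∀ k, b k < σ := fun k => by
    have : Nontrivial ι := Fintype.one_lt_card_iff_nontrivial.1 hcard
    obtain ⟨j, hj⟩ := exists_ne k
    exact Finset.single_lt_sum hj (Finset.mem_univ k) (Finset.mem_univ j) (hb0 j)
      fun i _ _ => (hb0 i).le
  obtain ⟨t, ht⟩ := h (fun k => σ / b k) (fun k => (one_lt_div (hb0 k)).2 (hbσ k)) (by
    simp only [one_div_div]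
    rw [← Finset.sum_div, div_self hσ0.ne'])
  rw [supDistEqTwo_iff hz1.le fun u => hS.norm_le]
  intro δ hδ
  obtain ⟨u, hu1, hu2, hu3⟩ := ht.exists_of_ne_zero (hk0 t) (hb0 t) (half_pos hδ)
    (show ‖ψ t‖ - b t < RCLike.re (ψ t (z t)) by simp only [hb, ha]; linarith)
  simp only [div_mul_cancel₀ _ (hb0 t).ne'] at hu2
  have hd0 : 0 < (α - σ) / Fintype.card ι := div_pos (by linarith) hc0
  choose v hv hv' using fun k => exists_re_apply_gt (ψ k) (sub_lt_self _ hd0)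
  refine ⟨Function.update v t u, (hmem _).2 ⟨?_, ?_⟩, ?_⟩
  · refine (pi_norm_le_iff_of_nonneg zero_le_one).2 fun j => ?_
    rcases eq_or_ne j t with rfl | hj
    · simpa using hu1
    · simpa [Function.update_of_ne hj] using hv j
  · have hlow : ∀ k, ‖ψ k‖ - (α - σ) / Fintype.card ι - (if k = t then σ else 0) <
        RCLike.re (ψ k (Function.update v t u k)) := fun k => by
      rcases eq_or_ne k t with rfl | hk
      · rw [if_pos rfl, Function.update_self]; linarith
      · rw [if_neg hk, sub_zero, Function.update_of_ne hk]; exact hv' k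
    rw [hreφ]
    refine lt_of_eq_of_lt ?_ (Finset.sum_lt_sum_of_nonempty Finset.univ_nonempty
      fun k _ => hlow k)
    rw [Finset.sum_sub_distrib, Finset.sum_sub_distrib, hsum, Finset.sum_const,
      Finset.card_univ, nsmul_eq_mul, mul_div_cancel₀ _ hc0.ne', Finset.sum_ite_eq']
    simp only [Finset.mem_univ, if_true]
    ring
  · have := norm_le_pi_norm (z - Function.update v t u) t
    rw [Pi.sub_apply, Function.update_self] at this
    linarith

end PiSpace

/-! ### The Shilov boundary, peak functions and isolated points. -/

section Shilov

variable {𝕜 : Type*} [RCLike 𝕜] {K : Type*} [TopologicalSpace K] [CompactSpace K]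
  {X : Type*} [NormedAddCommGroup X] [NormedSpace 𝕜 X]

theorem exists_norm_apply_eq_norm [Nonempty K] (g : C(K, X)) : ∃ t, ‖g t‖ = ‖g‖ := by
  obtain ⟨t, -, ht⟩ := isCompact_univ.exists_isMaxOn Set.univ_nonempty
    (g.continuous.norm.continuousOn (s := Set.univ))
  exact ⟨t, le_antisymm (g.norm_coe_le_norm t)
    ((ContinuousMap.norm_le _ (norm_nonneg _)).2 fun s => ht (Set.mem_univ s))⟩

/-- Zorn's lemma: by compactness the closed norm-attaining set of each function still meets the
intersection of a chain of closed boundaries. -/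
theorem exists_minimal_closed_boundary [Nonempty K] (B : Set C(K, 𝕜)) :
    ∃ m, Minimal (fun S => IsClosed S ∧ IsBoundaryFor B S) m := by
  refine zorn_superset {S | IsClosed S ∧ IsBoundaryFor B S} fun c hc hchain => ?_
  rcases c.eq_empty_or_nonempty with rfl | hne
  · refine ⟨Set.univ, ⟨isClosed_univ, fun φ _ => ?_⟩, by simp⟩
    obtain ⟨t, ht⟩ := exists_norm_apply_eq_norm φ
    exact ⟨t, Set.mem_univ t, ht⟩
  · refine ⟨⋂₀ c, ⟨isClosed_sInter fun s hs => (hc hs).1, fun φ hφ => ?_⟩,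
      fun s hs => Set.sInter_subset_of_mem hs⟩
    have hcl : IsClosed {t | ‖φ t‖ = ‖φ‖} := isClosed_eq (by fun_prop) continuous_const
    have : Nonempty c := hne.to_subtype
    have hinter : (⋂ s : c, (s : Set K) ∩ {t | ‖φ t‖ = ‖φ‖}).Nonempty := by
      refine IsCompact.nonempty_iInter_of_directed_nonempty_isCompact_isClosed _ ?_ ?_
        (fun s => ((hc s.2).1.inter hcl).isCompact) (fun s => (hc s.2).1.inter hcl)
      · intro s s'
        rcases hchain.total s.2 s'.2 with h | h
        · exact ⟨s, subset_rfl, Set.inter_subset_inter_left _ h⟩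
        · exact ⟨s', Set.inter_subset_inter_left _ h, subset_rfl⟩
      · rintro ⟨s, hs⟩
        obtain ⟨t, ht, ht'⟩ := (hc hs).2 φ hφ
        exact ⟨t, ht, ht'⟩
    obtain ⟨t, ht⟩ := hinter
    simp only [Set.mem_iInter, Set.mem_inter_iff, Subtype.forall] at ht
    exact ⟨t, fun s hs => (ht s hs).1, (ht _ hne.some_mem).2⟩

theorem exists_finset_separating {B : Subalgebra 𝕜 C(K, 𝕜)} (hB : B.SeparatesPoints) {F : Set K}
    (hF : IsClosed F) {s : K} (hs : s ∉ F) :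
    ∃ Φ : Finset C(K, 𝕜), (∀ φ ∈ Φ, φ ∈ B ∧ φ s = 0) ∧ ∀ t ∈ F, ∃ φ ∈ Φ, 1 < ‖φ t‖ := by
  have h1 : ∀ t ∈ F, ∃ φ ∈ B, φ s = 0 ∧ 1 < ‖φ t‖ := by
    intro t ht
    obtain ⟨_, ⟨φ, hφ, rfl⟩, hne⟩ := hB (show t ≠ s by rintro rfl; exact hs ht)
    have hne' : φ t - φ s ≠ 0 := sub_ne_zero.2 hne
    refine ⟨(2 / (φ t - φ s)) • (φ - algebraMap 𝕜 _ (φ s)),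
      B.smul_mem (B.sub_mem hφ (B.algebraMap_mem _)) _, by simp, ?_⟩
    have : ((2 / (φ t - φ s)) • (φ - algebraMap 𝕜 C(K, 𝕜) (φ s))) t = 2 := by
      simp [hne']
    rw [this, RCLike.norm_ofNat]
    norm_num
  choose! φ hφB hφs hφt using h1
  obtain ⟨T, hTF, hT⟩ := hF.isCompact.elim_nhds_subcover (fun t => {u | 1 < ‖φ t u‖})
    fun t ht => (isOpen_lt continuous_const (by fun_prop)).mem_nhds (hφt t ht)
  classical
  refine ⟨T.image φ, ?_, fun t ht => ?_⟩
  · simp only [Finset.mem_image]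
    rintro _ ⟨t, ht, rfl⟩
    exact ⟨hφB t (hTF t ht), hφs t (hTF t ht)⟩
  · obtain ⟨u, hu, htu⟩ := Set.mem_iUnion₂.1 (hT ht)
    exact ⟨φ u, Finset.mem_image_of_mem _ hu, htu⟩

theorem exists_pow_mul_lt {r M : ℝ} (hr0 : 0 ≤ r) (hr : r < 1) : ∃ n : ℕ, r ^ n * M < 1 := by
  have : Filter.Tendsto (fun n : ℕ => r ^ n * M) Filter.atTop (𝓝 (0 * M)) :=
    (tendsto_pow_atTop_nhds_zero_of_lt_one hr0 hr).mul_const M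
  rw [zero_mul] at this
  exact (this.eventually (gt_mem_nhds one_pos)).exists

theorem exists_lt_one_forall_norm_le {F : Set K} (hF : IsClosed F) {φ : C(K, 𝕜)}
    (h : ∀ t ∈ F, ‖φ t‖ < 1) : ∃ r, 0 ≤ r ∧ r < 1 ∧ ∀ t ∈ F, ‖φ t‖ ≤ r := by
  rcases F.eq_empty_or_nonempty with rfl | hne
  · exact ⟨0, le_rfl, one_pos, by simp⟩
  · obtain ⟨t, ht, hmax⟩ := hF.isCompact.exists_isMaxOn hne
      (φ.continuous.norm.continuousOn (s := F))
    exact ⟨‖φ t‖, norm_nonneg _, h t ht, fun s hs => hmax hs⟩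

/-- If a closed set is not a boundary, this is witnessed by a function of norm one. -/
theorem exists_norm_one_of_not_isBoundaryFor [Nonempty K] {B : Subalgebra 𝕜 C(K, 𝕜)} {F : Set K}
    (hF : ¬ IsBoundaryFor (B : Set C(K, 𝕜)) F) :
    ∃ φ ∈ B, ‖φ‖ = 1 ∧ ∀ t ∈ F, ‖φ t‖ < 1 := by
  simp only [IsBoundaryFor, SetLike.mem_coe, not_forall, not_exists, not_and] at hF
  obtain ⟨φ, hφ, hφF⟩ := hF
  rcases F.eq_empty_or_nonempty with rfl | ⟨u, hu⟩
  · exact ⟨1, B.one_mem, by simp, by simp⟩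
  have hlt : ∀ t ∈ F, ‖φ t‖ < ‖φ‖ := fun t ht => (φ.norm_coe_le_norm t).lt_of_ne (hφF t ht)
  have hpos : 0 < ‖φ‖ := (norm_nonneg _).trans_lt (hlt u hu)
  have hn : ‖((‖φ‖⁻¹ : ℝ) : 𝕜)‖ = ‖φ‖⁻¹ := by
    rw [RCLike.norm_ofReal, abs_of_pos (inv_pos.2 hpos)]
  refine ⟨((‖φ‖⁻¹ : ℝ) : 𝕜) • φ, B.smul_mem hφ _, ?_, fun t ht => ?_⟩
  · rw [norm_smul, hn, inv_mul_cancel₀ hpos.ne']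
  · rw [ContinuousMap.smul_apply, norm_smul, hn, ← div_eq_inv_mul, div_lt_one hpos]
    exact hlt t ht

/-- If `s ∈ m` is outside `F`, finitely many functions vanishing at `s` cut out a neighbourhood `U`
of `s` missing `F`. By minimality some `g` of norm 1 is strictly smaller than 1 in modulus on `m \
U`. For large n all the products `g ^ n * φ` are below 1 on `m`, but one of them exceeds 1 where `g`
attains its norm on `F`. -/
theorem minimal_closed_boundary_subset [Nonempty K] {B : Subalgebra 𝕜 C(K, 𝕜)}
    (hB : B.SeparatesPoints) {m : Set K}
    (hm : Minimal (fun S => IsClosed S ∧ IsBoundaryFor (B : Set C(K, 𝕜)) S) m)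
    {F : Set K} (hF : IsClosed F) (hFB : IsBoundaryFor (B : Set C(K, 𝕜)) F) : m ⊆ F := by
  intro s hsm
  by_contra hsF
  obtain ⟨Φ, hΦ, hΦF⟩ := exists_finset_separating hB hF hsF
  set U : Set K := {t | ∀ φ ∈ Φ, ‖φ t‖ < 1} with hU
  have hUo : IsOpen U := by
    have : U = ⋂ φ ∈ Φ, {t | ‖φ t‖ < 1} := by ext; simp [hU]
    rw [this]
    exact isOpen_biInter_finset fun φ _ => isOpen_lt (by fun_prop) continuous_const
  have hnot : ¬ IsBoundaryFor (B : Set C(K, 𝕜)) (m \ U) := fun hb =>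
    (hm.2 ⟨hm.1.1.sdiff hUo, hb⟩ Set.sdiff_subset hsm).2 fun φ hφ => by simp [(hΦ φ hφ).2]
  obtain ⟨g, hg, hg1, hgm⟩ := exists_norm_one_of_not_isBoundaryFor hnot
  obtain ⟨r, hr0, hr1, hr⟩ := exists_lt_one_forall_norm_le (hm.1.1.sdiff hUo) hgm
  obtain ⟨n, hn⟩ := exists_pow_mul_lt (M := ∑ φ ∈ Φ, ‖φ‖) hr0 hr1
  obtain ⟨t, htF, ht⟩ := hFB g hg
  rw [hg1] at ht
  obtain ⟨φ, hφ, hφt⟩ := hΦF t htF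
  obtain ⟨u, hum, hu⟩ := hm.1.2 (g ^ n * φ) (B.mul_mem (B.pow_mem hg n) (hΦ φ hφ).1)
  have h1 : ‖g u‖ ≤ 1 := hg1 ▸ g.norm_coe_le_norm u
  have h2 : ‖g u ^ n * φ u‖ < 1 := by
    rw [norm_mul, norm_pow]
    by_cases huU : u ∈ U
    · calc ‖g u‖ ^ n * ‖φ u‖ ≤ 1 * ‖φ u‖ :=
            mul_le_mul_of_nonneg_right (pow_le_one₀ (norm_nonneg _) h1) (norm_nonneg _)
        _ < 1 := by rw [one_mul]; exact huU φ hφ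
    · refine lt_of_le_of_lt ?_ hn
      gcongr
      · exact hr u ⟨hum, huU⟩
      · exact (φ.norm_coe_le_norm u).trans
          (Finset.single_le_sum (f := fun φ => ‖φ‖) (fun _ _ => norm_nonneg _) hφ)
  have h3 : ‖g t ^ n * φ t‖ ≤ ‖g ^ n * φ‖ := (g ^ n * φ).norm_coe_le_norm t
  rw [← hu] at h3
  have h4 : ‖(g ^ n * φ) u‖ < 1 := h2
  rw [norm_mul, norm_pow, ht, one_pow, one_mul] at h3
  linarith

/-- The Shilov boundary of a uniform algebra is a boundary. -/
theorem isBoundaryFor_shilovBoundary [Nonempty K] {B : Subalgebra 𝕜 C(K, 𝕜)}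
    (hB : B.SeparatesPoints) :
    IsBoundaryFor (B : Set C(K, 𝕜)) (shilovBoundary (B : Set C(K, 𝕜))) := by
  obtain ⟨m, hm⟩ := exists_minimal_closed_boundary (B : Set C(K, 𝕜))
  have : shilovBoundary (B : Set C(K, 𝕜)) = m := by
    refine Set.Subset.antisymm (Set.sInter_subset_of_mem hm.1) ?_
    exact Set.subset_sInter fun F hF => minimal_closed_boundary_subset hB hm hF.1 hF.2
  exact this ▸ hm.1.2

/-- Functions of the algebra that peak in an open set meeting the Shilov boundary. -/
theorem exists_peak [Nonempty K] {B : Subalgebra 𝕜 C(K, 𝕜)} (hB : B.SeparatesPoints) {U : Set K}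
    (hU : IsOpen U) (hne : (U ∩ shilovBoundary (B : Set C(K, 𝕜))).Nonempty) :
    ∃ φ ∈ B, ∃ s ∈ U ∩ shilovBoundary (B : Set C(K, 𝕜)), φ s = 1 ∧ ‖φ‖ = 1 ∧
      ∃ r, 0 ≤ r ∧ r < 1 ∧ ∀ t ∉ U, ‖φ t‖ ≤ r := by
  obtain ⟨u, huU, hu⟩ := hne
  have hnot : ¬ IsBoundaryFor (B : Set C(K, 𝕜)) Uᶜ := fun hb =>
    hu _ ⟨hU.isClosed_compl, hb⟩ huU
  obtain ⟨φ, hφ, hφ1, hφU⟩ := exists_norm_one_of_not_isBoundaryFor hnot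
  obtain ⟨r, hr0, hr1, hr⟩ := exists_lt_one_forall_norm_le hU.isClosed_compl hφU
  obtain ⟨s, hs, hφs⟩ := isBoundaryFor_shilovBoundary hB φ hφ
  rw [hφ1] at hφs
  have hsU : s ∈ U := by
    by_contra hsU
    exact (hφU s hsU).ne hφs
  have hne : φ s ≠ 0 := norm_ne_zero_iff.1 (by rw [hφs]; exact one_ne_zero)
  have hn : ‖(φ s)⁻¹‖ = 1 := by rw [norm_inv, hφs, inv_one]
  refine ⟨(φ s)⁻¹ • φ, B.smul_mem hφ _, s, ⟨hsU, hs⟩, by simp [hne], ?_, r, hr0, hr1,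
    fun t ht => ?_⟩
  · rw [norm_smul, hn, one_mul, hφ1]
  · rw [ContinuousMap.smul_apply, norm_smul, hn, one_mul]
    exact hr t ht

theorem exists_peak_le [Nonempty K] {B : Subalgebra 𝕜 C(K, 𝕜)} (hB : B.SeparatesPoints)
    {U : Set K} (hU : IsOpen U) (hne : (U ∩ shilovBoundary (B : Set C(K, 𝕜))).Nonempty)
    {ε : ℝ} (hε : 0 < ε) :
    ∃ φ ∈ B, ∃ s ∈ U ∩ shilovBoundary (B : Set C(K, 𝕜)), φ s = 1 ∧ (∀ t, ‖φ t‖ ≤ 1) ∧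
      ∀ t ∉ U, ‖φ t‖ ≤ ε := by
  obtain ⟨φ, hφ, s, hs, hφs, hφ1, r, hr0, hr1, hr⟩ := exists_peak hB hU hne
  obtain ⟨n, hn⟩ := exists_pow_lt_of_lt_one hε hr1
  refine ⟨φ ^ n, B.pow_mem hφ n, s, hs, by simp [hφs], fun t => ?_, fun t ht => ?_⟩
  · rw [ContinuousMap.pow_apply, norm_pow]
    exact pow_le_one₀ (norm_nonneg _) (hφ1 ▸ φ.norm_coe_le_norm t)
  · rw [ContinuousMap.pow_apply, norm_pow]
    exact (pow_le_pow_left₀ (norm_nonneg _) (hr t ht) n).trans hn.le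

/-- The indicator function of an isolated point of the Shilov boundary is, on the boundary,
a function of the algebra. -/
theorem exists_indicator_of_isolated [Nonempty K] {B : Subalgebra 𝕜 C(K, 𝕜)}
    (hB : B.SeparatesPoints) (hBc : IsClosed (B : Set C(K, 𝕜))) {t : K}
    (ht : t ∈ shilovBoundary (B : Set C(K, 𝕜)))
    (ht' : t ∉ derivedSet (shilovBoundary (B : Set C(K, 𝕜)))) :
    ∃ e ∈ B, e t = 1 ∧ ∀ s ∈ shilovBoundary (B : Set C(K, 𝕜)), s ≠ t → e s = 0 := by
  set Γ := shilovBoundary (B : Set C(K, 𝕜)) with hΓ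
  obtain ⟨U, hU, htU, hUΓ⟩ : ∃ U, IsOpen U ∧ t ∈ U ∧ ∀ s ∈ Γ, s ∈ U → s = t := by
    rw [mem_derivedSet, accPt_iff_nhds] at ht'
    push Not at ht'
    obtain ⟨U, hU, h⟩ := ht'
    obtain ⟨V, hVU, hV, htV⟩ := mem_nhds_iff.1 hU
    exact ⟨V, hV, htV, fun s hs hsV => h s ⟨hVU hsV, hs⟩⟩
  obtain ⟨φ, hφ, s, ⟨hsU, hs⟩, hφs, hφ1, r, hr0, hr1, hr⟩ := exists_peak hB hU ⟨t, htU, ht⟩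
  obtain rfl : s = t := hUΓ s hs hsU
  have hr' : ∀ u ∈ Γ, u ≠ s → ‖φ u‖ ≤ r := fun u hu hus => hr u fun huU => hus (hUΓ u hu huU)
  -- Norms in the algebra are computed on Γ, where the powers are 1 at the isolated point and at
  -- most r^n elsewhere.
  have hcauchy : CauchySeq fun n : ℕ => φ ^ n := by
    refine cauchySeq_of_le_tendsto_0 (fun n => 2 * r ^ n) (fun n k N hn hk => ?_) ?_
    · rw [dist_eq_norm]
      obtain ⟨u, hu, hux⟩ := isBoundaryFor_shilovBoundary hB (φ ^ n - φ ^ k)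
        (B.sub_mem (B.pow_mem hφ n) (B.pow_mem hφ k))
      rw [← hux, ContinuousMap.sub_apply, ContinuousMap.pow_apply, ContinuousMap.pow_apply]
      by_cases hus : u = s
      · simp only [hus, hφs, one_pow, sub_self, norm_zero]
        positivity
      · have h1 : ∀ j, N ≤ j → ‖φ u ^ j‖ ≤ r ^ N := fun j hj => by
          rw [norm_pow]
          exact (pow_le_pow_left₀ (norm_nonneg _) (hr' u hu hus) j).trans
            (pow_le_pow_of_le_one hr0 hr1.le hj)
        linarith [norm_sub_le (φ u ^ n) (φ u ^ k), h1 n hn, h1 k hk]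
    · simpa using (tendsto_pow_atTop_nhds_zero_of_lt_one hr0 hr1).const_mul 2
  obtain ⟨e, he⟩ := cauchySeq_tendsto_of_complete hcauchy
  have hpt : ∀ u, Filter.Tendsto (fun n : ℕ => φ u ^ n) Filter.atTop (𝓝 (e u)) := fun u =>
    ((continuous_eval_const (F := C(K, 𝕜)) u).tendsto e).comp he
  refine ⟨e, hBc.mem_of_tendsto he (.of_forall fun n => B.pow_mem hφ n), ?_, fun u hu hus => ?_⟩
  · refine tendsto_nhds_unique (hpt s) ?_
    simp [hφs]
  · exact tendsto_nhds_unique (hpt u) (tendsto_pow_atTop_nhds_zero_of_norm_lt_one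
      ((hr' u hu hus).trans_lt hr1))

end Shilov

/-! ### Polynomials mapping the unit disc close to the segment [0,1]. -/

section LogPolynomial

open Polynomial

/-- A scaled logarithm that maps the unit disc close to the segment `[0, 1]`. -/
def thinLog (d : ℝ) (z : ℂ) : ℂ := -Complex.log ((1 + d : ℝ) - z) / (-Real.log d : ℝ)

theorem thinLog_one {d : ℝ} (hd : 0 < d) (hd1 : d < 1) : thinLog d 1 = 1 := by
  have hlog : Real.log d ≠ 0 := (Real.log_neg hd hd1).ne
  have : (((1 + d : ℝ) : ℂ) - 1) = (d : ℝ) := by push_cast; ring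
  rw [thinLog, this, ← Complex.ofReal_log hd.le, Complex.ofReal_neg, neg_div_neg_eq,
    div_self (by exact_mod_cast hlog)]

theorem norm_thinLog_zero_le {d : ℝ} (hd : 0 < d) (hd1 : d < 1) :
    ‖thinLog d 0‖ ≤ 1 / -Real.log d := by
  have hL : 0 < -Real.log d := neg_pos.2 (Real.log_neg hd hd1)
  rw [thinLog, sub_zero, ← Complex.ofReal_log (by linarith), norm_div, norm_neg,
    Complex.norm_real, Complex.norm_real, Real.norm_of_nonneg hL.le,
    Real.norm_of_nonneg (Real.log_nonneg (by linarith))]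
  gcongr
  linarith [Real.log_le_sub_one_of_pos (show 0 < 1 + d by linarith)]

/-- The number 1 + d - z has real part at least d and modulus at most 3, so its logarithm has real
part between log d and 2 and imaginary part at most 2 in modulus. Dividing by `-log d` flattens the
image onto [0,1] as d tends to 0. -/
theorem norm_thinLog_add_le {d : ℝ} (hd : 0 < d) (hd1 : d < 1) {z : ℂ} (hz : ‖z‖ ≤ 1) :
    ‖thinLog d z‖ + ‖1 - thinLog d z‖ ≤ 1 + 8 / -Real.log d := by
  set L := -Real.log d with hL
  have hL0 : 0 < L := neg_pos.2 (Real.log_neg hd hd1)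
  set w : ℂ := (1 + d : ℝ) - z with hw
  have hre : d ≤ w.re := by
    have := (Complex.re_le_norm z).trans hz
    simp only [hw, Complex.sub_re, Complex.ofReal_re]
    linarith
  have hnorm1 : d ≤ ‖w‖ := hre.trans (Complex.re_le_norm w)
  have hnorm2 : ‖w‖ ≤ 3 := by
    refine (norm_sub_le _ _).trans ?_
    rw [Complex.norm_real, Real.norm_of_nonneg (by linarith)]
    linarith
  have hlog1 : -L ≤ Real.log ‖w‖ := by
    rw [hL, neg_neg]; exact Real.log_le_log hd hnorm1
  have hlog2 : Real.log ‖w‖ ≤ 2 := by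
    linarith [Real.log_le_sub_one_of_pos (hd.trans_le hnorm1)]
  have harg : |w.arg| ≤ 2 := by
    have := Complex.abs_arg_le_pi_div_two_iff.2 (hd.le.trans hre)
    linarith [Real.pi_lt_four]
  have hq : thinLog d z = ((-Real.log ‖w‖ / L : ℝ) : ℂ) + ((-w.arg / L : ℝ) : ℂ) * Complex.I := by
    rw [thinLog, ← hw, ← hL]
    conv_lhs => rw [← Complex.re_add_im (Complex.log w), Complex.log_re, Complex.log_im]
    push_cast
    ring
  have him : ‖((-w.arg / L : ℝ) : ℂ) * Complex.I‖ ≤ 2 / L := by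
    rw [norm_mul, Complex.norm_I, mul_one, Complex.norm_real, Real.norm_eq_abs, abs_div, abs_neg,
      abs_of_pos hL0]
    gcongr
  have h1 : -Real.log ‖w‖ / L ≤ 1 := by rw [div_le_one hL0]; linarith
  have h2 : -(2 / L) ≤ -Real.log ‖w‖ / L := by
    rw [← neg_div]; gcongr
  have h3 : ‖((-Real.log ‖w‖ / L : ℝ) : ℂ)‖ + ‖1 - ((-Real.log ‖w‖ / L : ℝ) : ℂ)‖ ≤
      1 + 4 / L := by
    rw [← Complex.ofReal_one, ← Complex.ofReal_sub, Complex.norm_real, Complex.norm_real,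
      Real.norm_eq_abs, Real.norm_of_nonneg (by linarith)]
    have h4 : 4 / L = 2 / L + 2 / L := by ring
    have h5 : 0 < 2 / L := by positivity
    rcases abs_cases (-Real.log ‖w‖ / L) with h | h <;> linarith
  have h4 := norm_add_le ((-Real.log ‖w‖ / L : ℝ) : ℂ) (((-w.arg / L : ℝ) : ℂ) * Complex.I)
  have h5 := norm_sub_le (1 - ((-Real.log ‖w‖ / L : ℝ) : ℂ)) (((-w.arg / L : ℝ) : ℂ) * Complex.I)
  have h6 : 8 / L = 4 / L + 2 / L + 2 / L := by ring
  rw [hq, ← sub_sub]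
  linarith

theorem exists_polynomial_near_thinLog {d : ℝ} (hd : 0 < d) (hd1 : d < 1) {e : ℝ} (he : 0 < e) :
    ∃ P : ℝ[X], ∀ z : ℂ, ‖z‖ ≤ 1 → ‖aeval z P - thinLog d z‖ ≤ e := by
  set L := -Real.log d with hL
  have hL0 : 0 < L := neg_pos.2 (Real.log_neg hd hd1)
  set ρ : ℝ := (1 + d)⁻¹ with hρ
  have hρ0 : 0 < ρ := inv_pos.2 (by linarith)
  have hρ1 : ρ < 1 := inv_lt_one_of_one_lt₀ (by linarith)
  obtain ⟨n, hn⟩ := exists_pow_lt_of_lt_one (show 0 < e * L * (1 - ρ) by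
    have := sub_pos.2 hρ1; positivity) hρ1
  -- Write 1 + d - z = (1 + d)(1 - ρz) and truncate the logarithmic series, which converges
  -- uniformly on the closed disc since ρ < 1. The term j = 0 vanishes because division by zero
  -- gives 0.
  refine ⟨C (-1 / L) * (C (Real.log (1 + d)) +
    ∑ j ∈ Finset.range (n + 1), C ((-1) ^ (j + 1) / (j : ℝ)) * (C (-ρ) * X) ^ j), fun z hz => ?_⟩
  have hv : ‖-(ρ : ℂ) * z‖ ≤ ρ := by
    rw [norm_mul, norm_neg, Complex.norm_real, Real.norm_of_nonneg hρ0.le]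
    exact mul_le_of_le_one_right hρ0.le hz
  have hne : 1 + -(ρ : ℂ) * z ≠ 0 := by
    intro h0
    have h1 : -(ρ : ℂ) * z = -1 := by linear_combination h0
    rw [h1, norm_neg, norm_one] at hv
    linarith
  have hlog : Complex.log ((1 + d : ℝ) - z) =
      Real.log (1 + d) + Complex.log (1 + -(ρ : ℂ) * z) := by
    rw [← Complex.log_ofReal_mul (by linarith) hne]
    congr 1
    have : ((1 + d : ℝ) : ℂ) * ρ = 1 := by
      rw [← Complex.ofReal_mul, hρ, mul_inv_cancel₀ (by linarith), Complex.ofReal_one]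
    linear_combination z * this
  have hP : aeval z (C (-1 / L) * (C (Real.log (1 + d)) +
      ∑ j ∈ Finset.range (n + 1), C ((-1) ^ (j + 1) / (j : ℝ)) * (C (-ρ) * X) ^ j)) =
      -1 / L * (Real.log (1 + d) + Complex.logTaylor (n + 1) (-(ρ : ℂ) * z)) := by
    simp only [map_mul, map_add, map_sum, map_pow, aeval_C, aeval_X, Complex.logTaylor,
      Complex.coe_algebraMap]
    push_cast
    congr 2
    exact Finset.sum_congr rfl fun j _ => by ring
  rw [hP, thinLog, hlog, ← hL]
  have h1 : -1 / (L : ℂ) * (Real.log (1 + d) + Complex.logTaylor (n + 1) (-(ρ : ℂ) * z)) -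
      -(Real.log (1 + d) + Complex.log (1 + -(ρ : ℂ) * z)) / L =
      (Complex.log (1 + -(ρ : ℂ) * z) - Complex.logTaylor (n + 1) (-(ρ : ℂ) * z)) / L := by ring
  rw [h1, norm_div, Complex.norm_real, Real.norm_of_nonneg hL0.le, div_le_iff₀ hL0]
  refine (Complex.norm_log_sub_logTaylor_le n (hv.trans_lt hρ1)).trans ?_
  have h2 : ‖-(ρ : ℂ) * z‖ ^ (n + 1) ≤ ρ ^ n :=
    (pow_le_pow_left₀ (norm_nonneg _) hv _).trans
      (pow_le_pow_of_le_one hρ0.le hρ1.le (Nat.le_succ n))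
  have h3 : (1 - ‖-(ρ : ℂ) * z‖)⁻¹ ≤ (1 - ρ)⁻¹ :=
    inv_anti₀ (sub_pos.2 hρ1) (by linarith)
  have h4 : (0 : ℝ) ≤ (1 - ‖-(ρ : ℂ) * z‖)⁻¹ := inv_nonneg.2 (by linarith)
  calc _ ≤ ‖-(ρ : ℂ) * z‖ ^ (n + 1) * (1 - ‖-(ρ : ℂ) * z‖)⁻¹ :=
        div_le_self (by positivity) (by linarith [(Nat.cast_nonneg n : (0 : ℝ) ≤ n)])
    _ ≤ ρ ^ n * (1 - ρ)⁻¹ := by gcongr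
    _ ≤ e * L := by
        rw [← div_eq_mul_inv, div_le_iff₀ (sub_pos.2 hρ1)]
        exact hn.le

theorem exists_thin_polynomial_complex {ε : ℝ} (hε : 0 < ε) :
    ∃ P : ℝ[X], (∀ z : ℂ, ‖z‖ ≤ 1 → ‖aeval z P‖ + ‖1 - aeval z P‖ ≤ 1 + ε) ∧
      aeval (1 : ℂ) P = 1 ∧ ‖aeval (0 : ℂ) P‖ < ε := by
  -- This makes `-log d = 16 / ε`, so the error 8/L is ε/2; the two uses of the ε/4 approximation
  -- take the other half.
  set d := Real.exp (-(16 / ε)) with hd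
  have hd0 : 0 < d := Real.exp_pos _
  have hd1 : d < 1 := Real.exp_lt_one_iff.2 (by rw [neg_lt_zero]; positivity)
  have hL : -Real.log d = 16 / ε := by rw [hd, Real.log_exp, neg_neg]
  obtain ⟨Q, hQ⟩ := exists_polynomial_near_thinLog hd0 hd1 (show 0 < ε / 8 by linarith)
  have h1 : (aeval (1 : ℂ) Q) = ((Q.eval 1 : ℝ) : ℂ) := by
    have := aeval_algebraMap_apply_eq_algebraMap_eval (A := ℂ) (1 : ℝ) Q
    rwa [map_one] at this
  have hP : ∀ z : ℂ, aeval z (Q + C (1 - Q.eval 1)) = aeval z Q + (1 - aeval 1 Q) := fun z => by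
    rw [map_add, aeval_C, h1]
    simp
  have hnear : ∀ z : ℂ, ‖z‖ ≤ 1 → ‖aeval z (Q + C (1 - Q.eval 1)) - thinLog d z‖ ≤ ε / 4 := by
    intro z hz
    have h2 := hQ 1 (by simp)
    rw [thinLog_one hd0 hd1] at h2
    have h3 : aeval z (Q + C (1 - Q.eval 1)) - thinLog d z =
        (aeval z Q - thinLog d z) - (aeval 1 Q - 1) := by rw [hP]; ring
    rw [h3]
    linarith [norm_sub_le (aeval z Q - thinLog d z) (aeval 1 Q - 1), hQ z hz]
  -- The constant correction makes the value at 1 exactly 1, at the cost of doubling the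
  -- approximation error.
  refine ⟨Q + C (1 - Q.eval 1), fun z hz => ?_, by rw [hP]; ring, ?_⟩
  · have h2 := norm_thinLog_add_le hd0 hd1 hz
    have h3 : 8 / (16 / ε) = ε / 2 := by field_simp; norm_num
    rw [hL, h3] at h2
    have h4 := norm_le_norm_add_norm_sub' (aeval z (Q + C (1 - Q.eval 1))) (thinLog d z)
    have h5 := norm_le_norm_add_norm_sub' (1 - aeval z (Q + C (1 - Q.eval 1))) (1 - thinLog d z)
    rw [sub_sub_sub_cancel_left, norm_sub_rev (thinLog d z)] at h5
    linarith [hnear z hz]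
  · have h2 := norm_thinLog_zero_le hd0 hd1
    have h3 : 1 / (16 / ε) = ε / 16 := by field_simp
    rw [hL, h3] at h2
    have h4 := norm_le_norm_add_norm_sub' (aeval 0 (Q + C (1 - Q.eval 1))) (thinLog d 0)
    linarith [hnear 0 (by simp)]

variable {𝕜 : Type*} [RCLike 𝕜]

/-- The isometric embedding of a real or complex field into `ℂ`. -/
def rclikeToComplex (𝕜 : Type*) [RCLike 𝕜] : 𝕜 →ₐ[ℝ] ℂ where
  toFun z := ⟨RCLike.re z, RCLike.im z⟩
  map_one' := by apply Complex.ext <;> simp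
  map_mul' z w := by apply Complex.ext <;> simp
  map_zero' := by apply Complex.ext <;> simp
  map_add' z w := by apply Complex.ext <;> simp
  commutes' r := by apply Complex.ext <;> simp

theorem norm_rclikeToComplex (z : 𝕜) : ‖rclikeToComplex 𝕜 z‖ = ‖z‖ := by
  rw [← sq_eq_sq₀ (norm_nonneg _) (norm_nonneg _), RCLike.norm_sq_eq_def (z := z), Complex.sq_norm,
    Complex.normSq_apply]
  rfl

/-- Real coefficients make evaluation commute with the isometric embedding into ℂ, so one complex
estimate serves both scalar fields. -/
theorem exists_thin_polynomial (𝕜 : Type*) [RCLike 𝕜] {ε : ℝ} (hε : 0 < ε) :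
    ∃ P : ℝ[X], (∀ z : 𝕜, ‖z‖ ≤ 1 → ‖aeval z P‖ + ‖1 - aeval z P‖ ≤ 1 + ε) ∧
      aeval (1 : 𝕜) P = 1 ∧ ∃ r > 0, ∀ z : 𝕜, ‖z‖ ≤ r → ‖aeval z P‖ ≤ ε := by
  obtain ⟨P, h1, h2, h3⟩ := exists_thin_polynomial_complex hε
  have hj : ∀ z : 𝕜, aeval (rclikeToComplex 𝕜 z) P = rclikeToComplex 𝕜 (aeval z P) :=
    fun z => aeval_algHom_apply _ _ _
  refine ⟨P, fun z hz => ?_, ?_, ?_⟩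
  · have := h1 (rclikeToComplex 𝕜 z) (by rwa [norm_rclikeToComplex])
    rwa [hj, ← map_one (rclikeToComplex 𝕜), ← map_sub, norm_rclikeToComplex,
      norm_rclikeToComplex] at this
  · refine (rclikeToComplex 𝕜).toRingHom.injective ?_
    have := hj 1
    rw [map_one, h2] at this
    exact this.symm.trans (map_one _).symm
  · have h0 : ‖aeval (0 : 𝕜) P‖ < ε := by
      rwa [← norm_rclikeToComplex, ← hj, map_zero]
    have hc : Continuous fun z : 𝕜 => ‖aeval z P‖ := (P.continuous_aeval).norm
    obtain ⟨r, hr, h⟩ := Metric.eventually_nhds_iff_ball.1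
      (hc.tendsto 0 |>.eventually (gt_mem_nhds h0))
    refine ⟨r / 2, half_pos hr, fun z hz => (h z ?_).le⟩
    rw [mem_ball_zero_iff]
    linarith

end LogPolynomial

/-! ### Thin peak functions in the algebra. -/

section ThinPeak

variable {𝕜 : Type*} [RCLike 𝕜] {K : Type*} [TopologicalSpace K] [CompactSpace K]

/-- Peak functions with values close to the segment `[0, 1]`. -/
theorem exists_thin_peak [Nonempty K] {B : Subalgebra 𝕜 C(K, 𝕜)} (hB : B.SeparatesPoints)
    {U : Set K} (hU : IsOpen U) (hne : (U ∩ shilovBoundary (B : Set C(K, 𝕜))).Nonempty)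
    {ε : ℝ} (hε : 0 < ε) :
    ∃ p ∈ B, ∃ s ∈ U ∩ shilovBoundary (B : Set C(K, 𝕜)), p s = 1 ∧
      (∀ t, ‖p t‖ + ‖1 - p t‖ ≤ 1 + ε) ∧ ∀ t ∉ U, ‖p t‖ ≤ ε := by
  obtain ⟨P, hP1, hP2, r, hr, hP3⟩ := exists_thin_polynomial 𝕜 hε
  obtain ⟨φ, hφ, s, hs, hφs, hφ1, hφU⟩ := exists_peak_le hB hU hne hr
  have heval : ∀ t, (Polynomial.aeval φ (P.map (algebraMap ℝ 𝕜))) t = Polynomial.aeval (φ t) P :=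
    fun t => by
      rw [← Polynomial.aeval_map_algebraMap 𝕜 (φ t) P]
      exact (Polynomial.aeval_algHom_apply (ContinuousMap.evalAlgHom 𝕜 𝕜 t) φ _).symm
  refine ⟨Polynomial.aeval φ (P.map (algebraMap ℝ 𝕜)), ?_, s, hs, ?_, fun t => ?_, fun t ht => ?_⟩
  · exact Algebra.adjoin_le (Set.singleton_subset_iff.2 hφ)
      (Polynomial.aeval_mem_adjoin_singleton _ _)
  · rw [heval, hφs, hP2]
  · rw [heval]; exact hP1 _ (hφ1 t)
  · rw [heval]; exact hP3 _ (hφU t ht)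

end ThinPeak

/-! ### Norm attained at a limit point of the Shilov boundary. -/

section CcsDaugavet

variable {𝕜 : Type*} [RCLike 𝕜] {K : Type*} [TopologicalSpace K]
  {X : Type*} [NormedAddCommGroup X] [NormedSpace 𝕜 X]

/-- Evaluation at a point as a continuous linear map on a space of continuous functions. -/
def evalOn (A : Submodule 𝕜 C(K, X)) (t : K) : A →L[𝕜] X :=
  (ContinuousMap.evalCLM 𝕜 t).comp A.subtypeL

theorem evalOn_apply (A : Submodule 𝕜 C(K, X)) (t : K) (g : A) :
    evalOn A t g = (g : C(K, X)) t := rfl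

theorem infinite_inter_of_mem_derivedSet [T1Space K] {G V : Set K} {t : K}
    (ht : t ∈ derivedSet G) (hV : IsOpen V) (htV : t ∈ V) : (V ∩ G).Infinite := by
  intro hfin
  rw [mem_derivedSet, accPt_iff_nhds] at ht
  have hcl : IsClosed ((V ∩ G) \ {t}) := (hfin.subset Set.sdiff_subset).isClosed
  obtain ⟨y, ⟨⟨hyV, hyn⟩, hyG⟩, hyt⟩ := ht (V \ ((V ∩ G) \ {t}))
    ((hV.sdiff hcl).mem_nhds ⟨htV, fun h => h.2 rfl⟩)
  exact hyn ⟨⟨hyV, hyG⟩, hyt⟩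

theorem sum_norm_le_of_pairwiseDisjoint {F : Finset K} {U : K → Set K}
    (hU : (F : Set K).PairwiseDisjoint U) {p : K → C(K, 𝕜)} {a b : ℝ} (ha : 0 ≤ a)
    (h1 : ∀ x ∈ F, ∀ t, ‖p x t‖ ≤ a) (h2 : ∀ x ∈ F, ∀ t ∉ U x, ‖p x t‖ ≤ b) (hb : 0 ≤ b) (t : K) :
    ∑ x ∈ F, ‖p x t‖ ≤ a + F.card * b := by
  classical
  calc ∑ x ∈ F, ‖p x t‖ ≤ ∑ x ∈ F, ((if t ∈ U x then a else 0) + b) :=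
        Finset.sum_le_sum fun x hx => by
          split_ifs with h
          · linarith [h1 x hx t]
          · linarith [h2 x hx t h]
    _ = (F.filter fun x => t ∈ U x).card * a + F.card * b := by
        rw [Finset.sum_add_distrib, ← Finset.sum_filter, Finset.sum_const, Finset.sum_const,
          nsmul_eq_mul, nsmul_eq_mul]
    _ ≤ a + F.card * b := by
        have hcard : (F.filter fun x => t ∈ U x).card ≤ 1 := by
          rw [Finset.card_le_one]
          intro x hx y hy
          rw [Finset.mem_filter] at hx hy
          by_contra hne
          exact Set.disjoint_left.1 (hU hx.1 hy.1 hne) hx.2 hy.2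
        have : ((F.filter fun x => t ∈ U x).card : ℝ) ≤ 1 := by exact_mod_cast hcard
        nlinarith

variable [CompactSpace K]

theorem norm_evalOn_le {A : Submodule 𝕜 C(K, X)} (t : K) (g : A) : ‖evalOn A t g‖ ≤ ‖g‖ :=
  (g : C(K, X)).norm_coe_le_norm t

theorem norm_le_of_forall_evalOn {A : Submodule 𝕜 C(K, X)} {g : A} {M : ℝ} (hM : 0 ≤ M)
    (h : ∀ t, ‖evalOn A t g‖ ≤ M) : ‖g‖ ≤ M :=
  (ContinuousMap.norm_le _ hM).2 h

/-- Unimodular coefficients align all the values `φ (v x)`. This bounds the total effect on `φ` of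
perturbations with almost disjoint supports, independently of their number. -/
theorem sum_norm_apply_le {E : Type*} [NormedAddCommGroup E] [NormedSpace 𝕜 E]
    (φ : StrongDual 𝕜 E) {α : Type*} (F : Finset α) (v : α → E) {M : ℝ}
    (h : ∀ θ : α → 𝕜, (∀ x, ‖θ x‖ = 1) → ‖∑ x ∈ F, θ x • v x‖ ≤ M) :
    ∑ x ∈ F, ‖φ (v x)‖ ≤ ‖φ‖ * M := by
  choose θ hθ hθv using fun x => RCLike.exists_norm_eq_mul_self (φ (v x))
  have h1 : ((∑ x ∈ F, ‖φ (v x)‖ : ℝ) : 𝕜) = φ (∑ x ∈ F, θ x • v x) := by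
    rw [map_sum, RCLike.ofReal_sum]
    exact Finset.sum_congr rfl fun x _ => by rw [map_smul, smul_eq_mul, hθv]
  have h2 : ∑ x ∈ F, ‖φ (v x)‖ = ‖φ (∑ x ∈ F, θ x • v x)‖ := by
    rw [← h1, RCLike.norm_ofReal, abs_of_nonneg (Finset.sum_nonneg fun _ _ => norm_nonneg _)]
  rw [h2]
  exact (φ.le_opNorm _).trans (mul_le_mul_of_nonneg_left (h θ hθ) (norm_nonneg _))

theorem isCcsDaugavetPoint_of_mem_derivedSet [T2Space K] {A : Submodule 𝕜 C(K, X)}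
    (hA : IsAKX A) {f : A} (hf : ‖f‖ = 1) {t₀ : K}
    (ht₀ : t₀ ∈ derivedSet (shilovBoundary (baseAlgebra A))) (hft₀ : ‖(f : C(K, X)) t₀‖ = 1) :
    IsCcsDaugavetPoint 𝕜 f := by
  have : Nonempty K := ⟨t₀⟩
  obtain ⟨B, hBA, -, hsep⟩ := hA.base
  refine ⟨hf, fun C hC => ?_⟩
  rw [supDistEqTwo_iff hf.le fun y => hC.norm_le]
  intro ε hε
  obtain ⟨n, lam, S, hlam, hlam1, hS, rfl⟩ := hC
  choose φ e hφ he hmem using fun i => (hS i).exists_mem_iff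
  choose g hg using fun i => (hS i).nonempty
  have hg' := fun i => (hmem i _).1 (hg i)
  obtain ⟨r, hr0, hr1, hr⟩ := exists_pos_le_one_forall_le
    (η := fun i => RCLike.re (φ i (g i)) - (1 - e i)) fun i => sub_pos.2 (hg' i).2
  -- Here `r` is the smallest slack of the `g i` in their slices. The share r/3 absorbs the
  -- perturbation and the rescaling by 1/(1 + δ); the share ε/4 covers the final loss, since (2 -
  -- δ)(1 - δ) ≥ 2 - 3δ.
  set δ : ℝ := min (r / 3) (ε / 4) with hδ
  have hδ0 : 0 < δ := lt_min (by linarith) (by linarith)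
  have hδr : δ ≤ r / 3 := min_le_left _ _
  have hδε : δ ≤ ε / 4 := min_le_right _ _
  set V : Set K := {t | 1 - δ < ‖(f : C(K, X)) t‖} with hV
  have hVo : IsOpen V := isOpen_lt continuous_const (by fun_prop)
  have hinf := infinite_inter_of_mem_derivedSet ht₀ hVo
    (show 1 - δ < ‖(f : C(K, X)) t₀‖ by rw [hft₀]; linarith)
  obtain ⟨N, hN⟩ := exists_nat_gt (6 * n / δ)
  have hN0 : (0 : ℝ) < N := lt_of_le_of_lt (by positivity) hN
  obtain ⟨F, hFsub, hFcard⟩ := hinf.exists_subset_card_eq N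
  obtain ⟨U, hU, hUdisj⟩ := F.finite_toSet.t2_separation
  have hpeak : ∀ x ∈ F, ∃ p ∈ baseAlgebra A, ∃ s ∈ V, p s = 1 ∧
      (∀ t, ‖p t‖ + ‖1 - p t‖ ≤ 1 + δ) ∧ ∀ t ∉ U x, ‖p t‖ ≤ δ / N := by
    intro x hx
    rw [← hBA] at hFsub ⊢
    obtain ⟨p, hp, s, hs, hps, hp1, hp2⟩ := exists_thin_peak hsep ((hU x).2.inter hVo)
      ⟨x, ⟨(hU x).1, (hFsub hx).1⟩, (hFsub hx).2⟩ (div_pos hδ0 hN0)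
    have hle : δ / N ≤ δ := div_le_self hδ0.le (by
      have : 0 < N := by exact_mod_cast hN0
      exact_mod_cast this)
    exact ⟨p, hp, s, hs.1.2, hps, fun t => (hp1 t).trans (by linarith),
      fun t ht => hp2 t fun h => ht h.1⟩
  choose! p hpA s hsV hps hp1 hp2 using hpeak
  have hpn : ∀ x ∈ F, ∀ t, ‖p x t‖ ≤ 1 + δ := fun x hx t => by
    linarith [hp1 x hx t, norm_nonneg (1 - p x t)]
  have hbump : ∀ (i : Fin n) (x : K), ∃ v : A,
      x ∈ F → ∀ t, (v : C(K, X)) t = p x t • ((g i + f : A) : C(K, X)) t := by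
    intro i x
    by_cases hx : x ∈ F
    · exact ⟨⟨p x • ((g i + f : A) : C(K, X)), hA.smul_mem _ (hpA x hx) _ (g i + f).2⟩,
        fun _ t => rfl⟩
    · exact ⟨0, fun h => absurd h hx⟩
  choose v hv using hbump
  have hgf : ∀ i, ‖g i + f‖ ≤ 2 := fun i =>
    (norm_add_le _ _).trans (by linarith [(hg' i).1])
  -- The constant 6 is 3 · 2: the moduli of the peaks sum to at most 1 + 2δ ≤ 3, and `‖g i + f‖ ≤
  -- 2`.
  have hsumv : ∀ i, ∑ x ∈ F, ‖φ i (v i x)‖ ≤ 6 := by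
    intro i
    refine (sum_norm_apply_le (φ i) F (v i) (M := 6) fun θ hθ => ?_).trans
      (by rw [hφ, one_mul])
    refine norm_le_of_forall_evalOn (by norm_num) fun t => ?_
    have h1 : ((∑ x ∈ F, θ x • v i x : A) : C(K, X)) t =
        ∑ x ∈ F, θ x • p x t • ((g i + f : A) : C(K, X)) t := by
      rw [← evalOn_apply, map_sum]
      exact Finset.sum_congr rfl fun x hx => by rw [map_smul, evalOn_apply, hv i x hx]
    rw [evalOn_apply, h1]
    have h2 : ‖((g i + f : A) : C(K, X)) t‖ ≤ 2 := (norm_evalOn_le t (g i + f)).trans (hgf i)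
    calc _ ≤ ∑ x ∈ F, ‖p x t‖ * 2 := norm_sum_le_of_le _ fun x _ => by
          rw [norm_smul, norm_smul, hθ, one_mul]
          exact mul_le_mul_of_nonneg_left h2 (norm_nonneg _)
      _ = (∑ x ∈ F, ‖p x t‖) * 2 := (Finset.sum_mul _ _ _).symm
      _ ≤ (1 + δ + F.card * (δ / N)) * 2 := by
          have := sum_norm_le_of_pairwiseDisjoint hUdisj (a := 1 + δ) (by linarith)
            hpn hp2 (by positivity) t
          linarith
      _ ≤ 6 := by
          rw [hFcard, mul_div_cancel₀ _ hN0.ne']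
          linarith
  have hFne : F.Nonempty := by
    rw [← Finset.card_pos, hFcard]
    exact_mod_cast hN0
  -- Pigeonhole over the N > 6n/δ pieces; a single `x` works for all slices at once, which is what a
  -- ccs requires.
  obtain ⟨x, hx, hxle⟩ : ∃ x ∈ F, ∑ i, ‖φ i (v i x)‖ ≤ δ := by
    refine Finset.exists_le_of_sum_le hFne ?_
    rw [Finset.sum_comm, Finset.sum_const, hFcard, nsmul_eq_mul]
    calc _ ≤ ∑ _i : Fin n, (6 : ℝ) := Finset.sum_le_sum fun i _ => hsumv i
      _ = 6 * n := by rw [Finset.sum_const, Finset.card_univ, Fintype.card_fin, nsmul_eq_mul,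
          mul_comm]
      _ ≤ N * δ := ((div_lt_iff₀ hδ0).1 hN).le
  have hxi : ∀ i, ‖φ i (v i x)‖ ≤ δ := fun i =>
    (Finset.single_le_sum (f := fun i => ‖φ i (v i x)‖) (fun _ _ => norm_nonneg _)
      (Finset.mem_univ i)).trans hxle
  set c : ℝ := (1 + δ)⁻¹ with hc
  have hc0 : 0 < c := inv_pos.2 (by linarith)
  have hc1 : c * (1 + δ) = 1 := inv_mul_cancel₀ (by linarith)
  -- Each `g i - v i x` equals (1 - p)g_i - pf, of norm at most 1 + δ. At the peak `s x` it equals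
  -- `-f`, whatever `i` is.
  refine ⟨∑ i, ((lam i : ℝ) : 𝕜) • ((c : 𝕜) • (g i - v i x)), ⟨_, fun i => ?_, rfl⟩, ?_⟩
  · refine (hmem i _).2 ⟨?_, ?_⟩
    · rw [norm_smul, RCLike.norm_ofReal, abs_of_pos hc0, ← hc1]
      refine mul_le_mul_of_nonneg_left ?_ hc0.le
      refine norm_le_of_forall_evalOn (by linarith) fun t => ?_
      have h1 : ((g i - v i x : A) : C(K, X)) t =
          (1 - p x t) • (g i : C(K, X)) t - p x t • (f : C(K, X)) t := by
        rw [← evalOn_apply, map_sub, evalOn_apply, evalOn_apply, hv i x hx, ← evalOn_apply A t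
          (g i + f), map_add, evalOn_apply, evalOn_apply, smul_add, sub_smul, one_smul]
        abel
      have h2 : ‖(g i : C(K, X)) t‖ ≤ 1 := (norm_evalOn_le t (g i)).trans (hg' i).1
      have h3 : ‖(f : C(K, X)) t‖ ≤ 1 := (norm_evalOn_le t f).trans hf.le
      rw [evalOn_apply, h1]
      refine (norm_sub_le _ _).trans ?_
      rw [norm_smul, norm_smul]
      have h4 := mul_le_of_le_one_right (norm_nonneg (1 - p x t)) h2
      have h5 := mul_le_of_le_one_right (norm_nonneg (p x t)) h3
      linarith [hp1 x hx t]
    · rw [map_smul, smul_eq_mul, RCLike.re_ofReal_mul, map_sub, map_sub]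
      have h1 := (RCLike.re_le_norm (φ i (v i x))).trans (hxi i)
      have h2 : r ≤ RCLike.re (φ i (g i)) - (1 - e i) := hr i
      have h3 : (1 - e i) * (1 + δ) < RCLike.re (φ i (g i)) - RCLike.re (φ i (v i x)) := by
        nlinarith [he i]
      calc 1 - e i = c * ((1 - e i) * (1 + δ)) := by linear_combination (e i - 1) * hc1
        _ < _ := mul_lt_mul_of_pos_left h3 hc0
  · refine lt_of_lt_of_le ?_ (norm_evalOn_le (s x) _)
    have h1 : ∀ i, evalOn A (s x) (((lam i : ℝ) : 𝕜) • ((c : 𝕜) • (g i - v i x))) =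
        ((lam i : ℝ) : 𝕜) • -((c : 𝕜) • (f : C(K, X)) (s x)) := fun i => by
      rw [map_smul, map_smul, map_sub, evalOn_apply A (s x) (v i x), hv i x hx, hps x hx, one_smul,
        ← evalOn_apply A (s x) (g i + f), map_add, evalOn_apply A (s x) f, sub_add_cancel_left,
        smul_neg]
    rw [map_sub, map_sum, Finset.sum_congr rfl fun i _ => h1 i, ← Finset.sum_smul,
      ← RCLike.ofReal_sum, hlam1, RCLike.ofReal_one, one_smul, sub_neg_eq_add, evalOn_apply]
    have h2 : (f : C(K, X)) (s x) + (c : 𝕜) • (f : C(K, X)) (s x) =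
        ((1 + c : ℝ) : 𝕜) • (f : C(K, X)) (s x) := by
      rw [RCLike.ofReal_add, add_smul, RCLike.ofReal_one, one_smul]
    rw [h2, norm_smul, RCLike.norm_ofReal, abs_of_pos (by linarith)]
    have h3 : 1 - δ < ‖(f : C(K, X)) (s x)‖ := hsV x hx
    have h4 : 1 - δ ≤ c := by nlinarith
    nlinarith

end CcsDaugavet

/-! ### Restriction to isolated points of the Shilov boundary. -/

section Restriction

variable {𝕜 : Type*} [RCLike 𝕜] {K : Type*} [TopologicalSpace K] [CompactSpace K]
  {X : Type*} [NormedAddCommGroup X] [NormedSpace 𝕜 X] {A : Submodule 𝕜 C(K, X)}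

/-- Compose `g` with a functional norming its value at a maximum point. The result lies in the base
algebra and so attains its norm on Γ. -/
theorem IsAKX.exists_mem_shilovBoundary_norm_eq [Nonempty K] (hA : IsAKX A) (g : A) :
    ∃ t ∈ shilovBoundary (baseAlgebra A), ‖evalOn A t g‖ = ‖g‖ := by
  obtain ⟨B, hBA, -, hsep⟩ := hA.base
  obtain ⟨t, ht⟩ := exists_norm_apply_eq_norm (g : C(K, X))
  obtain ⟨ξ, hξ, hξt⟩ := exists_dual_vector'' 𝕜 ((g : C(K, X)) t)
  let φ : C(K, 𝕜) := ⟨fun s => ξ ((g : C(K, X)) s), by fun_prop⟩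
  have hφ : φ ∈ (B : Set C(K, 𝕜)) := hBA ▸ ⟨ξ, g, g.2, fun _ => rfl⟩
  obtain ⟨s, hs, hφs⟩ := isBoundaryFor_shilovBoundary hsep φ hφ
  rw [hBA] at hs
  refine ⟨s, hs, le_antisymm (norm_evalOn_le s g) ?_⟩
  have h1 : ‖φ s‖ ≤ ‖evalOn A s g‖ := (ξ.le_opNorm _).trans
    (mul_le_of_le_one_left (norm_nonneg _) hξ)
  have h2 : ‖φ t‖ = ‖g‖ := by
    change ‖ξ ((g : C(K, X)) t)‖ = _
    rw [hξt, RCLike.norm_ofReal, abs_norm, ht]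
    rfl
  calc ‖g‖ = ‖φ t‖ := h2.symm
    _ ≤ ‖φ‖ := φ.norm_coe_le_norm t
    _ ≤ _ := hφs ▸ h1

/-- `x ↦ e ⊗ x` for `e` in the base algebra. -/
def tensorCLM (hA : IsAKX A) {e : C(K, 𝕜)} (he : e ∈ baseAlgebra A) : X →L[𝕜] A :=
  LinearMap.mkContinuous
    { toFun := fun x => ⟨e • ContinuousMap.const K x, hA.tensor_mem e he x⟩
      map_add' := fun x y => by ext t; simp
      map_smul' := fun c x => by ext t; simp [smul_comm (e t) c] }
    ‖e‖ fun x => norm_le_of_forall_evalOn (by positivity) fun t => by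
      change ‖e t • x‖ ≤ _
      rw [norm_smul]
      exact mul_le_mul_of_nonneg_right (e.norm_coe_le_norm t) (norm_nonneg x)

theorem evalOn_tensorCLM (hA : IsAKX A) {e : C(K, 𝕜)} (he : e ∈ baseAlgebra A) (x : X) (t : K) :
    evalOn A t (tensorCLM hA he x) = e t • x := rfl

/-- Restriction to a finite set. -/
def restrictCLM (A : Submodule 𝕜 C(K, X)) (T : Finset K) : A →L[𝕜] (T → X) :=
  ContinuousLinearMap.pi fun t => evalOn A t

/-- The spaces `A(K, X)` have M-summands formed by isolated points of the Shilov boundary. -/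
theorem IsAKX.exists_isMSummand_restrictCLM [Nonempty K] (hA : IsAKX A) {T : Finset K}
    (hT : ∀ t ∈ T, t ∈ shilovBoundary (baseAlgebra A) ∧
      t ∉ derivedSet (shilovBoundary (baseAlgebra A))) :
    ∃ J : (T → X) →L[𝕜] A, IsMSummand (restrictCLM A T) J ∧
      ∀ u, ∀ s ∈ shilovBoundary (baseAlgebra A), s ∉ T → evalOn A s (J u) = 0 := by
  classical
  obtain ⟨B, hBA, hBc, hsep⟩ := hA.base
  have hind : ∀ t : T, ∃ e ∈ baseAlgebra A, e t = 1 ∧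
      ∀ s ∈ shilovBoundary (baseAlgebra A), s ≠ t → e s = 0 := by
    intro t
    have := hT t t.2
    rw [← hBA] at this ⊢
    exact exists_indicator_of_isolated hsep hBc this.1 this.2
  choose e he het hes using hind
  let J : (T → X) →L[𝕜] A := ∑ t : T, (tensorCLM hA (he t)).comp (ContinuousLinearMap.proj t)
  have hJ : ∀ u s, evalOn A s (J u) = ∑ t : T, e t s • u t := fun u s => by
    simp only [J, sum_apply, map_sum, ContinuousLinearMap.comp_apply, evalOn_tensorCLM,
      ContinuousLinearMap.proj_apply]
  have hJT : ∀ (u : T → X) (s : T), evalOn A s (J u) = u s := fun u s => by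
    rw [hJ, Finset.sum_eq_single s, het, one_smul]
    · intro t _ hts
      rw [hes t s (hT s s.2).1 fun h => hts (Subtype.ext h.symm), zero_smul]
    · exact fun h => absurd (Finset.mem_univ s) h
  have hJ0 : ∀ u, ∀ s ∈ shilovBoundary (baseAlgebra A), s ∉ T → evalOn A s (J u) = 0 := by
    intro u s hs hsT
    rw [hJ]
    refine Finset.sum_eq_zero fun t _ => ?_
    rw [hes t s hs fun h => hsT (h ▸ t.2), zero_smul]
  refine ⟨J, ⟨fun u => funext fun t => hJT u t, fun g => ?_, fun g => ?_, fun u g => ?_⟩, hJ0⟩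
  · exact (pi_norm_le_iff_of_nonneg (norm_nonneg _)).2 fun t => norm_evalOn_le t.1 g
  · obtain ⟨s, hs, hsn⟩ := hA.exists_mem_shilovBoundary_norm_eq (g - J (restrictCLM A T g))
    rw [← hsn, map_sub]
    by_cases hsT : s ∈ T
    · rw [hJT _ ⟨s, hsT⟩]
      change ‖evalOn A s g - evalOn A s g‖ ≤ _
      simp
    · rw [hJ0 _ s hs hsT, sub_zero]
      exact norm_evalOn_le s g
  · obtain ⟨s, hs, hsn⟩ :=
      hA.exists_mem_shilovBoundary_norm_eq (J u + (g - J (restrictCLM A T g)))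
    rw [← hsn, map_add]
    by_cases hsT : s ∈ T
    · rw [map_sub, hJT _ ⟨s, hsT⟩, hJT _ ⟨s, hsT⟩]
      change ‖u ⟨s, hsT⟩ + (evalOn A s g - evalOn A s g)‖ ≤ _
      rw [sub_self, add_zero]
      exact (norm_le_pi_norm u _).trans (le_max_left _ _)
    · rw [hJ0 _ s hs hsT, zero_add]
      exact (norm_evalOn_le s _).trans (le_max_right _ _)

/-- An infinite set would accumulate at a limit point of `G` at which, by continuity, `f` still
attains its norm. -/
theorem finite_isolatedNormPoints {G : Set K} {f : C(K, X)}
    (h : ¬ ∃ t ∈ derivedSet G, ‖f t‖ = ‖f‖) : (isolatedNormPoints G f).Finite := by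
  by_contra hinf
  obtain ⟨t, ht⟩ := Set.Infinite.exists_accPt_principal hinf
  refine h ⟨t, ?_, ?_⟩
  · exact derivedSet_mono _ _ (fun s hs => hs.1) ht
  · have hcl : IsClosed {s | ‖f s‖ = ‖f‖} := isClosed_eq (by fun_prop) continuous_const
    exact hcl.closure_subset_iff.2 (fun s hs => hs.2.2)
      (mem_closure_iff_clusterPt.2 ht.clusterPt)

end Restriction

end

/-! ### Assembly of the theorem. -/

theorem mainTheorem4 {𝕜 : Type*} [RCLike 𝕜]
    {K : Type*} [TopologicalSpace K] [CompactSpace K] [T2Space K]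
    {X : Type*} [NormedAddCommGroup X] [NormedSpace 𝕜 X] [CompleteSpace X]
    (A : Submodule 𝕜 C(K, X)) (hA : IsAKX A)
    (Γ : Set K) (hΓ : Γ = shilovBoundary (baseAlgebra A))
    (f : A) (hf : ‖f‖ = 1) :
    ((∃ t₀ ∈ derivedSet Γ, ‖(f : C(K, X)) t₀‖ = ‖f‖) → IsCcsDaugavetPoint 𝕜 f) ∧
    ((¬ ∃ t₀ ∈ derivedSet Γ, ‖(f : C(K, X)) t₀‖ = ‖f‖) →
      ∃ T : Finset K, (T : Set K) = isolatedNormPoints Γ (f : C(K, X)) ∧ T.Nonempty ∧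
        -- every function on `T` is the restriction of a member of `A` vanishing on the rest of `Γ`
        (∀ g : T → X, ∃ h ∈ A, restrictTo T h = g ∧ ∀ t ∈ Γ, t ∉ T → h t = 0) ∧
        -- (a)
        (IsSuperDaugavetPoint 𝕜 f ↔ IsSuperDaugavetPoint 𝕜 (restrictTo T (f : C(K, X)))) ∧
        (IsSuperDeltaPoint 𝕜 f ↔ IsSuperDeltaPoint 𝕜 (restrictTo T (f : C(K, X)))) ∧
        (IsCcsDaugavetPoint 𝕜 f ↔ IsCcsDaugavetPoint 𝕜 (restrictTo T (f : C(K, X)))) ∧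
        -- (b)
        (IsDaugavetPoint 𝕜 f ↔ ∃ t₀ ∈ T, IsDaugavetPoint 𝕜 ((f : C(K, X)) t₀)) ∧
        -- (c)
        (IsCcsDeltaPoint 𝕜 f → IsCcsDeltaPoint 𝕜 (restrictTo T (f : C(K, X)))) ∧
        -- (d)
        (IsDeltaPoint 𝕜 f ↔
          ((∃ t ∈ T, IsDeltaPoint 𝕜 ((f : C(K, X)) t)) ∨
            (2 ≤ T.card ∧ ∀ p : T → ℝ, (∀ t, 1 < p t) → ∑ t, 1 / p t = 1 →
              ∃ t : T, IsDeltaPPoint 𝕜 (p t) ((f : C(K, X)) t)))) ∧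
        -- (e), where the second alternative says that the scalar field is complex
        ((Γ ≠ (T : Set K) ∨ (RCLike.I : 𝕜) ≠ 0) →
          (IsNablaPoint 𝕜 f ↔ IsDaugavetPoint 𝕜 f)) ∧
        -- (f)
        (Γ = (T : Set K) →
          ((IsNablaPoint 𝕜 f ↔
            ((∀ t ∈ T, IsNablaPoint 𝕜 ((f : C(K, X)) t)) ∨
              ∃ t₀ ∈ T, IsDaugavetPoint 𝕜 ((f : C(K, X)) t₀))) ∧
          ((∃ t₀ ∈ T, IsDaugavetPoint 𝕜 ((f : C(K, X)) t₀)) → IsDaugavetPoint 𝕜 f)))) := by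
  classical
  subst hΓ
  constructor
  · rintro ⟨t₀, ht₀, hft₀⟩
    exact isCcsDaugavetPoint_of_mem_derivedSet hA hf ht₀ (hft₀.trans hf)
  intro hno
  have hK : Nonempty K := by
    by_contra hK
    rw [not_nonempty_iff] at hK
    have : f = 0 := Subtype.ext (ContinuousMap.ext fun t => hK.elim t)
    simp [this] at hf
  obtain ⟨T, hT⟩ := (finite_isolatedNormPoints hno).exists_finset_coe
  have hmemT : ∀ t, t ∈ T ↔ t ∈ shilovBoundary (baseAlgebra A) ∧
      t ∉ derivedSet (shilovBoundary (baseAlgebra A)) ∧ ‖evalOn A t f‖ = 1 := fun t => by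
    rw [← Finset.mem_coe, hT, ← hf]
    rfl
  have hlt : ∀ t ∈ shilovBoundary (baseAlgebra A), t ∉ T → ‖evalOn A t f‖ < 1 := by
    intro t ht htT
    refine lt_of_le_of_ne (hf ▸ norm_evalOn_le t f) fun h1 => htT ((hmemT t).2 ⟨ht, ?_, h1⟩)
    exact fun hd => hno ⟨t, hd, h1.trans hf.symm⟩
  obtain ⟨t₁, ht₁, hft₁⟩ := hA.exists_mem_shilovBoundary_norm_eq f
  have hTne : T.Nonempty := by
    refine ⟨t₁, ?_⟩
    by_contra h
    exact (hlt t₁ ht₁ h).ne (hft₁.trans hf)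
  obtain ⟨J, hJ, hJ0⟩ := hA.exists_isMSummand_restrictCLM
    fun t ht => ⟨((hmemT t).1 ht).1, ((hmemT t).1 ht).2.1⟩
  have hJT : ∀ (g : A), ∀ t ∈ T, evalOn A t (J (restrictCLM A T g)) = evalOn A t g :=
    fun g t ht => congr_fun (hJ.proj_inj (restrictCLM A T g)) ⟨t, ht⟩
  have hcompl : ‖f - J (restrictCLM A T f)‖ < 1 := by
    obtain ⟨s, hs, hsn⟩ := hA.exists_mem_shilovBoundary_norm_eq (f - J (restrictCLM A T f))
    rw [← hsn, map_sub]
    by_cases hsT : s ∈ T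
    · rw [hJT f s hsT, sub_self, norm_zero]; exact one_pos
    · rw [hJ0 _ s hs hsT, sub_zero]; exact hlt s hs hsT
  have : Nonempty T := hTne.to_subtype
  set z : T → X := restrictCLM A T f with hz
  have hz1 : ∀ t : T, ‖z t‖ = 1 := fun t => ((hmemT t).1 t.2).2.2
  have hz1' : ‖z‖ = 1 := pi_norm_eq_one hz1
  have hD : IsDaugavetPoint 𝕜 f ↔ ∃ t₀ ∈ T, IsDaugavetPoint 𝕜 ((f : C(K, X)) t₀) := by
    constructor
    · intro h
      obtain ⟨t, ht⟩ := exists_isDaugavetPoint_apply hz1 (hJ.isDaugavetPoint_proj hcompl h)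
      exact ⟨t, t.2, ht⟩
    · rintro ⟨t, ht, h⟩
      exact hJ.isDaugavetPoint_lift hf
        ((isMSummand_proj_single (⟨t, ht⟩ : T)).isDaugavetPoint_lift hz1' h)
  refine ⟨T, hT, hTne, fun g => ⟨J g, (J g).2, hJ.proj_inj g, fun t ht htT => hJ0 g t ht htT⟩,
    ⟨hJ.isSuperDaugavetPoint_proj hcompl, hJ.isSuperDaugavetPoint_lift hf⟩,
    ⟨hJ.isSuperDeltaPoint_proj hcompl, hJ.isSuperDeltaPoint_lift hf⟩,
    ⟨hJ.isCcsDaugavetPoint_proj hcompl, hJ.isCcsDaugavetPoint_lift hf⟩, hD,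
    hJ.isCcsDeltaPoint_proj hcompl, ⟨fun h => ?_, ?_⟩, fun h => ⟨fun hn => ?_,
    IsDaugavetPoint.isNablaPoint⟩, fun hΓT => ⟨⟨fun hn => ?_, ?_⟩, hD.2⟩⟩
  · have hzΔ := hJ.isDeltaPoint_proj hcompl h
    refine or_iff_not_imp_left.2 fun hnot => ⟨?_, fun p hp hp1 =>
      exists_isDeltaPPoint_apply hz1 hzΔ hp hp1⟩
    -- When T is a singleton, the coordinate projection is an isometry onto `X`, so the Δ property
    -- passes to the value of `f`, against the assumption.
    by_contra hcard
    have hcard1 : T.card ≤ 1 := by omega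
    have hsub : Subsingleton T := Finset.card_le_one_iff_subsingleton_coe.1 hcard1
    obtain ⟨t⟩ := ‹Nonempty T›
    refine hnot ⟨t, t.2, (isMSummand_proj_single t).isDeltaPoint_proj ?_ hzΔ⟩
    have h0 : z - ContinuousLinearMap.single 𝕜 (fun _ : T => X) t
        (ContinuousLinearMap.proj (R := 𝕜) (φ := fun _ : T => X) t z) = 0 := by
      funext s
      obtain rfl := Subsingleton.elim s t
      simp
    rw [h0, norm_zero]
    exact one_pos
  · rintro (⟨t, ht, h⟩ | ⟨hcard, h⟩)
    · exact hJ.isDeltaPoint_lift hf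
        ((isMSummand_proj_single (⟨t, ht⟩ : T)).isDeltaPoint_lift hz1' h)
    · exact hJ.isDeltaPoint_lift hf (isDeltaPoint_pi hz1 (by rwa [Fintype.card_coe]) h)
  · rcases h with hne | hI
    · obtain ⟨t, htΓ, htT⟩ : ∃ t ∈ shilovBoundary (baseAlgebra A), t ∉ T := by
        by_contra! hall
        exact hne (Set.Subset.antisymm hall fun t ht => ((hmemT t).1 ht).1)
      have h1 : (1 : C(K, 𝕜)) ∈ baseAlgebra A := by
        obtain ⟨B, hBA, -⟩ := hA.base
        exact hBA ▸ B.one_mem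
      set x : X := evalOn A t₁ f with hx
      set g : A := tensorCLM hA h1 x with hg
      -- A nonzero complement element: the constant function `x ≠ 0` with its part on T removed,
      -- still equal to `x` at the point `t` of Γ outside T.
      refine hJ.isDaugavetPoint_of_isNablaPoint hcompl (w := g - J (restrictCLM A T g)) ?_ ?_ hn
      · intro h0
        have h2 := congr_arg (evalOn A t) h0
        rw [map_sub, map_zero, hJ0 _ t htΓ htT, sub_zero, hg, evalOn_tensorCLM,
          ContinuousMap.one_apply, one_smul] at h2
        rw [h2, hf, norm_zero] at hft₁
        exact zero_ne_one hft₁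
      · rw [map_sub, hJ.proj_inj, sub_self]
    · exact hn.isDaugavetPoint_of_complex hI
  · rw [or_iff_not_imp_right]
    intro hnot t ht
    exact isNablaPoint_apply hz1 (hJ.isNablaPoint_proj hcompl hn)
      (fun ⟨s, hs⟩ => hnot ⟨s, s.2, hs⟩) ⟨t, ht⟩
  · rintro (h | h)
    · refine hJ.isNablaPoint_lift (fun g => ?_) (isNablaPoint_pi fun t => h t t.2)
      obtain ⟨s, hs, hsn⟩ := hA.exists_mem_shilovBoundary_norm_eq (J (restrictCLM A T g) - g)
      have hsT : s ∈ T := by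
        rw [← Finset.mem_coe, ← hΓT]; exact hs
      rw [map_sub, hJT g s hsT, sub_self, norm_zero] at hsn
      exact sub_eq_zero.1 (norm_eq_zero.1 hsn.symm)
    · exact (hD.2 h).isNablaPoint
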